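/- Let $g\ge 0$ and let $\mathbb{R}\langle x,x^T\rangle$ be the ring of noncommutative (nc) real polynomials in the variables $x_1,\dots,x_g$ and their formal transposes $x_1^T,\dots,x_g^T$, with the linear involution $p\mapsto p^T$ that reverses products and exchanges $x_j$ with $x_j^T$; $p$ is symmetric if $p^T=p$. Nc polynomials in $x,x^T,h,h^T$, with further variables $h_1,\dots,h_g$ and their formal transposes, are defined in the same way. The nc complex hessian of $p$ is $$q(x,x^T)[h,h^T]=\frac{\partial^2}{\partial s\,\partial t}\,p(x+th,\,y+sk)\Big|_{t=s=0}\Big|_{y=x^T,\;k=h^T},$$ where $p(x,y)$ is obtained from $p$ by writing $y_j$ for $x_j^T$. A set $\mathcal G=\bigcup_{n\ge1}\mathcal G_n$ with $\mathcal G_n\subseteq(\mathbb{R}^{n\times n})^g$ is an nc open set if it is closed under finite (nonempty) direct sums and there is a positive integer $n_0$ such that $\mathcal G_n$ is open for all $n>n_0$. A symmetric nc polynomial $p$ is nc plurisubharmonic on $\mathcal G$ if $q(X,X^T)[H,H^T]\succeq0$ for all $n\ge1$, all $X\in\mathcal G_n$ and all $H\in(\mathbb{R}^{n\times n})^g$.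 **Theorem.** Let $p\in\mathbb{R}\langle x,x^T\rangle$ be a symmetric nc polynomial that is nc plurisubharmonic on a nonempty nc open set. Then its nc complex hessian $q$ can be written as $$q=V(x,x^T)[h,h^T]^T\,L(x,x^T)\,D\,L(x,x^T)^T\,V(x,x^T)[h,h^T],$$ where, for some integer $\mathcal N\ge0$, $V$ is a vector of $\mathcal N$ distinct border monomials, i.e. monomials of the form $h_jm$ or $h_j^Tm$ with $m$ a monomial in $x,x^T$; $D=\operatorname{diag}(d_1,\dots,d_{\mathcal N})$ is a constant real matrix with all $d_i\ge0$ (so $D$ is positive semidefinite); and $L$ is an $\mathcal N\times\mathcal N$ unit lower triangular matrix with entries in $\mathbb{R}\langle x,x^T\rangle$. (The transpose of a matrix or vector with nc polynomial entries also applies the involution to each entry.) -/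

import Mathlib

open scoped Matrix

noncomputable section

namespace NCPlush

/-- The real polynomials in the noncommuting variables `v s` and `(v s)^T`, for `s : σ`.
The letter `Sum.inl s` is the variable `v s`, the letter `Sum.inr s` is its formal
transpose `(v s)^T`. For `σ = Fin g` these are the nc polynomials in `x, x^T`. For
`σ = Fin g ⊕ Fin g` they are the nc polynomials in `x, x^T, h, h^T`, where the summand
`inl` of `σ` carries the variables `x_j` and the summand `inr` the variables `h_j`. -/
abbrev NCPoly (σ : Type) : Type := FreeAlgebra ℝ (σ ⊕ σ)

section General

variable {σ : Type}

/-- The variable `v s`. -/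
def var (s : σ) : NCPoly σ := FreeAlgebra.ι ℝ (Sum.inl s)

/-- The formal transpose `(v s)^T` of the variable `v s`. -/
def varT (s : σ) : NCPoly σ := FreeAlgebra.ι ℝ (Sum.inr s)

/-- The involution `T` as a homomorphism to the opposite algebra: it is linear, reverses
products and exchanges each variable with its formal transpose. -/
def transposeHom (σ : Type) : NCPoly σ →ₐ[ℝ] (NCPoly σ)ᵐᵒᵖ :=
  FreeAlgebra.lift ℝ fun v => MulOpposite.op (FreeAlgebra.ι ℝ v.swap)

/-- The transpose `p^T` of an nc polynomial. (This is not the `star` of `FreeAlgebra`,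
which fixes the variables.) -/
def transpose (p : NCPoly σ) : NCPoly σ := (transposeHom σ p).unop

/-- `p` is symmetric: `p^T = p`. -/
def IsSymmetric (p : NCPoly σ) : Prop := transpose p = p

/-- The transpose of a matrix with nc polynomial entries: `(M^T) i j = (M j i)^T`. -/
def matrixTranspose {m n : Type} (M : Matrix m n (NCPoly σ)) : Matrix n m (NCPoly σ) :=
  Mᵀ.map transpose

/-- The evaluation `p(X, X^T)` at a tuple of real square matrices. -/
def eval {n : Type} [Fintype n] [DecidableEq n] (X : σ → Matrix n n ℝ) :
    NCPoly σ →ₐ[ℝ] Matrix n n ℝ :=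
  FreeAlgebra.lift ℝ (Sum.elim (fun s => X s) (fun s => (X s)ᵀ))

end General

section Hessian

variable {g : ℕ}

/-- `x_j`, as a polynomial in `x, x^T, h, h^T`. -/
def xv (j : Fin g) : NCPoly (Fin g ⊕ Fin g) := var (Sum.inl j)

/-- `x_j^T`, as a polynomial in `x, x^T, h, h^T`. -/
def xvT (j : Fin g) : NCPoly (Fin g ⊕ Fin g) := varT (Sum.inl j)

/-- `h_j`. -/
def hv (j : Fin g) : NCPoly (Fin g ⊕ Fin g) := var (Sum.inr j)

/-- `h_j^T`. -/
def hvT (j : Fin g) : NCPoly (Fin g ⊕ Fin g) := varT (Sum.inr j)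

/-- The inclusion of the polynomials in `x, x^T` into the polynomials in `x, x^T, h, h^T`. -/
def embed (g : ℕ) : NCPoly (Fin g) →ₐ[ℝ] NCPoly (Fin g ⊕ Fin g) :=
  FreeAlgebra.lift ℝ (Sum.elim xv xvT)

/-- `p(x + t h, y + s k)` at `y = x^T`, `k = h^T`: a polynomial in the two commuting real
parameters `t` (inner polynomial variable) and `s` (outer polynomial variable), with
coefficients the nc polynomials in `x, x^T, h, h^T`. -/
def perturb (g : ℕ) :
    NCPoly (Fin g) →ₐ[ℝ] Polynomial (Polynomial (NCPoly (Fin g ⊕ Fin g))) :=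
  FreeAlgebra.lift ℝ (Sum.elim
    (fun j => Polynomial.C (Polynomial.C (xv j) + Polynomial.X * Polynomial.C (hv j)))
    (fun j => Polynomial.C (Polynomial.C (xvT j)) +
      Polynomial.X * Polynomial.C (Polynomial.C (hvT j))))

/-- The nc complex hessian `q(x, x^T)[h, h^T]` of `p`: the mixed second derivative
`∂²/∂s∂t` of `p(x + t h, y + s k)` at `t = s = 0`, with `y = x^T` and `k = h^T`. -/
def complexHessian (p : NCPoly (Fin g)) : NCPoly (Fin g ⊕ Fin g) :=
  (Polynomial.derivative
    ((Polynomial.derivative (perturb g p)).eval 0)).eval 0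

end Hessian

section OpenSets

/-- A `g`-tuple of real `n × n` matrices. -/
abbrev MatTuple (g n : ℕ) : Type := Fin g → Matrix (Fin n) (Fin n) ℝ

/-- The direct sum `X 0 ⊕ ⋯ ⊕ X (t - 1)` of matrix tuples, formed entrywise as a block
diagonal matrix. -/
def directSum {g t : ℕ} (n : Fin t → ℕ) (X : ∀ i, MatTuple g (n i)) :
    MatTuple g (∑ i, n i) :=
  fun j => Matrix.reindex finSigmaFinEquiv finSigmaFinEquiv
    (Matrix.blockDiagonal' fun i => X i j)

/-- A graded set `𝒢 = ⋃_{n ≥ 1} 𝒢 n` (the value `𝒢 0` plays no role) is an nc open set: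
it respects direct sums, and `𝒢 n` is open for all large `n`. -/
structure IsNCOpen {g : ℕ} (𝒢 : ∀ n : ℕ, Set (MatTuple g n)) : Prop where
  directSum_mem : ∀ (t : ℕ) (n : Fin t → ℕ) (X : ∀ i, MatTuple g (n i)),
    1 ≤ t → (∀ i, 1 ≤ n i) → (∀ i, X i ∈ 𝒢 (n i)) → directSum n X ∈ 𝒢 (∑ i, n i)
  isOpen : ∃ n₀ : ℕ, 0 < n₀ ∧ ∀ n, n₀ < n → IsOpen (𝒢 n)

/-- `p` is nc plurisubharmonic on `𝒢`: its nc complex hessian satisfies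
`q(X, X^T)[H, H^T] ⪰ 0` for all `X ∈ 𝒢` and all `H` of the same size. -/
def IsPlushOn {g : ℕ} (p : NCPoly (Fin g)) (𝒢 : ∀ n : ℕ, Set (MatTuple g n)) : Prop :=
  ∀ n : ℕ, 1 ≤ n → ∀ X ∈ 𝒢 n, ∀ H : MatTuple g n,
    (eval (Sum.elim X H) (complexHessian p)).PosSemidef

end OpenSets

section Factorization

/-- A border monomial `h_j m` or `h_j^T m`, with `m` a monomial in `x, x^T`. The head
`Sum.inl j` stands for `h_j`, the head `Sum.inr j` for `h_j^T`; the tail is the word `m`. -/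
structure BorderMonomial (g : ℕ) where
  head : Fin g ⊕ Fin g
  tail : List (Fin g ⊕ Fin g)

/-- The nc polynomial `h_j m` or `h_j^T m`. -/
def BorderMonomial.toPoly {g : ℕ} (b : BorderMonomial g) : NCPoly (Fin g ⊕ Fin g) :=
  Sum.elim hv hvT b.head * (b.tail.map (Sum.elim xv xvT)).prod

/-- `L` is unit lower triangular: ones on the diagonal, zeros above it. -/
def IsUnitLowerTriangular {N : ℕ} {R : Type} [Zero R] [One R]
    (L : Matrix (Fin N) (Fin N) R) : Prop :=
  (∀ i, L i i = 1) ∧ ∀ i j, i < j → L i j = 0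

/-- The nc quadratic `V^T M V`, where `V` is a vector of border monomials and `M` is a
matrix of nc polynomials in `x, x^T`. -/
def quadraticForm {g N : ℕ} (V : Fin N → BorderMonomial g)
    (M : Matrix (Fin N) (Fin N) (NCPoly (Fin g))) : NCPoly (Fin g ⊕ Fin g) :=
  (fun i => transpose (V i).toPoly) ⬝ᵥ (M.map (embed g) *ᵥ fun i => (V i).toPoly)

end Factorization

end NCPlush

end

/-! Encode the border monomial `h_j m` by the ordinary word `x_j m`, and `h_j^T m` by `x_j^T m`. The
hessian splits into two quadratic forms, one for each type of border word, and in both the middle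
matrix has at position `(β, γ)` the polynomial in which `u` has coefficient `P (β^T u γ)`, the
coefficient of that word in `p` (`complexHessian_eq_middleForm`). Entries thus depend on
concatenated words only.

The factorization is Gaussian elimination, longest border words first. If the rows of all words
longer than `α` vanish, the diagonal entry of `α` is a constant: a letter of `u` in `α^T u α` can be
absorbed into one of the two border words, which makes it longer (`coeff_diag_eq_zero`). So one can
divide by the pivot. The Schur complement is again the middle matrix of a symmetric coefficient
family (`eliminate_apply`, `isSymmCoeff_eliminate`), and the step repeats (`exists_squares`).

Positivity is needed at a single point `X`, provided that for some `v` the vectors `m(X) v` with `m`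
of length at most `D` are independent. It makes pivots nonnegative, forces the row of a zero pivot
to vanish (`rowZero_of_coeff_diag`) and passes to the Schur complement (`isPosAt_eliminate`). It
comes from the hessian at `X ⊕ X` in an off-diagonal direction, where the border monomials of one
type take arbitrary values on `(v, 0)` and those of the other type vanish (`isPosAt_of_double`).
Such an `X` exists because direct sums reach an open level of large size, and independence follows
from a nonvanishing determinant, which is nonzero at a truncated Fock space tuple
(`exists_isDualFamily_of_isNCOpen`). -/

noncomputable section

namespace NCPlush

/-! ### Words, their transposes and their splittings -/

section Words

variable {σ : Type}

/-- A word in the letters `v s` and `(v s)^T`. -/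
abbrev Word (σ : Type) : Type := List (σ ⊕ σ)

/-- The transpose of a word. -/
def wordT (w : Word σ) : Word σ := (w.map Sum.swap).reverse

@[simp] lemma wordT_nil : wordT ([] : Word σ) = [] := rfl

@[simp] lemma wordT_cons (a : σ ⊕ σ) (w : Word σ) :
    wordT (a :: w) = wordT w ++ [a.swap] := by simp [wordT]

@[simp] lemma wordT_append (u v : Word σ) : wordT (u ++ v) = wordT v ++ wordT u := by
  simp [wordT]

@[simp] lemma wordT_wordT (w : Word σ) : wordT (wordT w) = w := by
  simp [wordT, List.map_reverse]

@[simp] lemma length_wordT (w : Word σ) : (wordT w).length = w.length := by simp [wordT]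

@[simp] lemma wordT_eq_nil (w : Word σ) : wordT w = [] ↔ w = [] := by simp [wordT]

lemma mem_wordT {a : σ ⊕ σ} {w : Word σ} : a ∈ wordT w ↔ a.swap ∈ w := by
  simp only [wordT, List.mem_reverse, List.mem_map]
  exact ⟨by rintro ⟨c, hc, rfl⟩; simpa using hc, fun h => ⟨_, h, by simp⟩⟩

/-- The word `w` is nonempty and its first letter is a variable if `b` is true, the transpose
of a variable if `b` is false. -/
def HasType (b : Bool) (w : Word σ) : Prop := w.head?.map Sum.isLeft = some b

instance (b : Bool) (w : Word σ) : Decidable (HasType b w) :=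
  inferInstanceAs (Decidable (_ = _))

@[simp] lemma not_hasType_nil (b : Bool) : ¬ HasType b ([] : Word σ) := by simp [HasType]

@[simp] lemma hasType_cons (b : Bool) (a : σ ⊕ σ) (w : Word σ) :
    HasType b (a :: w) ↔ a.isLeft = b := by simp [HasType]

lemma isLeft_swap_ne {b : Bool} {a : σ ⊕ σ} : a.swap.isLeft ≠ b ↔ a.isLeft = b := by
  cases a <;> cases b <;> simp

lemma isLeft_swap_eq {b : Bool} {a : σ ⊕ σ} : a.swap.isLeft = b ↔ a.isLeft ≠ b := by
  cases a <;> cases b <;> simp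

lemma HasType.exists_mem_wordT {b : Bool} {w : Word σ} (h : HasType b w) :
    ∃ a ∈ wordT w, a.isLeft ≠ b := by
  cases w with
  | nil => simp at h
  | cons a w => exact ⟨a.swap, by simp, isLeft_swap_ne.2 (by simpa using h)⟩

section Bounded

variable [Fintype σ]

/-- The words of length at most `D`. -/
def words (σ : Type) [Fintype σ] (D : ℕ) : Finset (Word σ) :=
  (List.finite_length_le (σ ⊕ σ) D).toFinset

@[simp] lemma mem_words {D : ℕ} {w : Word σ} : w ∈ words σ D ↔ w.length ≤ D := by
  simp [words]

lemma sum_words_wordT {M : Type} [AddCommMonoid M] (D : ℕ) (F : Word σ → M) :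
    ∑ w ∈ words σ D, F (wordT w) = ∑ w ∈ words σ D, F w :=
  Finset.sum_nbij' wordT wordT (by simp) (by simp) (by simp) (by simp) (by simp)

end Bounded

lemma finite_splits (w : Word σ) :
    {s : Word σ × Word σ | s.1 ++ s.2 = w}.Finite := by
  refine ((Set.finite_Iic w.length).image fun i => (w.take i, w.drop i)).subset ?_
  rintro ⟨l, r⟩ rfl
  exact ⟨l.length, by simp⟩

/-- The pairs of words `(l, r)` with `l ++ r = w`. -/
def splits (w : Word σ) : Finset (Word σ × Word σ) := (finite_splits w).toFinset

@[simp] lemma mem_splits {w : Word σ} {s : Word σ × Word σ} :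
    s ∈ splits w ↔ s.1 ++ s.2 = w := by simp [splits]

lemma sum_splits_nil {M : Type} [AddCommMonoid M] (F : Word σ → Word σ → M) :
    ∑ s ∈ splits ([] : Word σ), F s.1 s.2 = F [] [] := by
  have : splits ([] : Word σ) = {([], [])} := by
    ext ⟨l, r⟩
    simp
  simp [this]

lemma sum_splits_cons {M : Type} [AddCommMonoid M] (F : Word σ → Word σ → M)
    (a : σ ⊕ σ) (w : Word σ) :
    ∑ s ∈ splits (a :: w), F s.1 s.2 = F [] (a :: w) + ∑ s ∈ splits w, F (a :: s.1) s.2 := by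
  classical
  have h : splits (a :: w) = insert ([], a :: w)
      ((splits w).image fun s => (a :: s.1, s.2)) := by
    ext ⟨l, r⟩
    cases l with
    | nil => simp
    | cons c l =>
      simp only [mem_splits, List.cons_append, List.cons.injEq, Finset.mem_insert, Prod.mk.injEq,
        reduceCtorEq, false_and, Finset.mem_image, false_or, Prod.exists]
      constructor
      · rintro ⟨rfl, h⟩
        exact ⟨l, r, h, ⟨rfl, rfl⟩, rfl⟩
      · rintro ⟨l', r', h, ⟨rfl, rfl⟩, rfl⟩
        exact ⟨rfl, h⟩
  rw [h, Finset.sum_insert (by simp), Finset.sum_image]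
  rintro ⟨l, r⟩ _ ⟨l', r'⟩ _ h
  simpa using h

/-- Groups the pairs `(l, r)` by their concatenation; `hF` disposes of the pairs whose concatenation
is too long. -/
lemma sum_words_splits [Fintype σ] {M : Type} [AddCommMonoid M] (D : ℕ)
    (F : Word σ → Word σ → M) (hF : ∀ l r, D < l.length + r.length → F l r = 0) :
    ∑ w ∈ words σ D, ∑ s ∈ splits w, F s.1 s.2 =
      ∑ l ∈ words σ D, ∑ r ∈ words σ D, F l r := by
  classical
  rw [← Finset.sum_product', ← Finset.sum_filter_of_ne
    (p := fun s : Word σ × Word σ => s.1 ++ s.2 ∈ words σ D)]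
  · rw [← Finset.sum_fiberwise_of_maps_to (g := fun s : Word σ × Word σ => s.1 ++ s.2)
      (t := words σ D) (by simp)]
    refine Finset.sum_congr rfl fun w hw => Finset.sum_congr ?_ fun _ _ => rfl
    ext ⟨l, r⟩
    simp only [mem_splits, Finset.mem_filter, Finset.mem_product, mem_words,
      List.length_append] at hw ⊢
    constructor
    · rintro rfl
      simp only [List.length_append] at hw
      refine ⟨⟨⟨?_, ?_⟩, hw⟩, rfl⟩ <;> omega
    · exact fun h => h.2
  · intro s _ hs
    by_contra h
    exact hs (hF _ _ (by simpa using h))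

lemma sum_splits_wordT {M : Type} [AddCommMonoid M] (F : Word σ → Word σ → M) (w : Word σ) :
    ∑ s ∈ splits (wordT w), F s.1 s.2 = ∑ s ∈ splits w, F (wordT s.2) (wordT s.1) := by
  refine Finset.sum_nbij' (fun s => (wordT s.2, wordT s.1)) (fun s => (wordT s.2, wordT s.1))
    ?_ ?_ ?_ ?_ ?_
  · intro s hs
    simp only [mem_splits] at hs ⊢
    rw [← wordT_append, hs, wordT_wordT]
  · intro s hs
    simp only [mem_splits] at hs ⊢
    rw [← wordT_append, hs]
  all_goals simp

end Words

/-! ### One elimination step on coefficient families -/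

section Elimination

variable {σ : Type}

/-- The coefficients `P`, indexed by words, are those of a symmetric polynomial of degree at
most `D`. -/
structure IsSymmCoeff (D : ℕ) (P : Word σ → ℝ) : Prop where
  symm : ∀ w, P (wordT w) = P w
  eq_zero : ∀ w, D < w.length → P w = 0

/-- The row of the border word `β` in the middle matrix of type `b` vanishes. -/
def RowZero (b : Bool) (P : Word σ → ℝ) (β : Word σ) : Prop :=
  ∀ u γ, HasType b γ → P (wordT β ++ u ++ γ) = 0

/-- The row of the border word `α`, divided by its diagonal entry. -/
def pivotRow (b : Bool) (P : Word σ → ℝ) (α : Word σ) (γ : Word σ) : ℝ :=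
  if HasType b γ then P (wordT α ++ γ) / P (wordT α ++ α) else 0

/-- The coefficients that remain when the row of `α` is eliminated. -/
def eliminate (b : Bool) (P : Word σ → ℝ) (α : Word σ) (w : Word σ) : ℝ :=
  P w - P (wordT α ++ α) *
    ∑ s ∈ splits w, pivotRow b P α (wordT s.1) * pivotRow b P α s.2

variable {D : ℕ} {b : Bool} {P : Word σ → ℝ} {α : Word σ}

lemma IsSymmCoeff.rowZero_of_lt (hP : IsSymmCoeff D P) {β : Word σ} (h : D < β.length) :
    RowZero b P β := fun u γ _ => hP.eq_zero _ (by simp; omega)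

lemma IsSymmCoeff.apply_eq (hP : IsSymmCoeff D P) (β u γ : Word σ) :
    P (wordT β ++ u ++ γ) = P (wordT γ ++ wordT u ++ β) := by
  rw [← hP.symm]
  simp

/-- If all longer border words have zero rows, the words in the row of `α` have no letter of
the opposite type before the right border word. -/
lemma coeff_eq_zero_of_mem (hlong : ∀ β, HasType b β → α.length < β.length → RowZero b P β)
    {u β : Word σ} (hβ : HasType b β) {y : σ ⊕ σ} (hy : y ∈ u) (hyb : y.isLeft ≠ b) :
    P (wordT α ++ u ++ β) = 0 := by
  obtain ⟨u₁, u₂, rfl⟩ := List.append_of_mem hy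
  -- Read `α^T u₁ y` as the transpose of a border word of type `b` longer than `α`.
  have := hlong (y.swap :: (wordT u₁ ++ α)) (by simpa using isLeft_swap_eq.2 hyb)
    (by simp) u₂ β hβ
  simpa using this

/-- A letter of `u` of the opposite type lengthens the left border word; a letter of type `b` does
so after transposing. This is why the pivot is a scalar. -/
lemma coeff_diag_eq_zero (hP : IsSymmCoeff D P) (hα : HasType b α)
    (hlong : ∀ β, HasType b β → α.length < β.length → RowZero b P β) {u : Word σ}
    (hu : u ≠ []) : P (wordT α ++ u ++ α) = 0 := by
  obtain ⟨a, ha⟩ := List.exists_mem_of_ne_nil u hu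
  by_cases hab : a.isLeft = b
  · rw [hP.apply_eq]
    exact coeff_eq_zero_of_mem hlong hα (y := a.swap) (mem_wordT.2 (by simpa using ha))
      (isLeft_swap_ne.2 hab)
  · exact coeff_eq_zero_of_mem hlong hα ha hab

lemma pivotRow_of_not {γ : Word σ} (h : ¬ HasType b γ) : pivotRow b P α γ = 0 := if_neg h

/-- The type test in `pivotRow` costs nothing here: if it fails for `u ++ β`, then `u` begins with a
letter of the opposite type and the coefficient is zero anyway. -/
lemma pivotRow_append (hlong : ∀ β, HasType b β → α.length < β.length → RowZero b P β)
    {u β : Word σ} (hβ : HasType b β) :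
    pivotRow b P α (u ++ β) = P (wordT α ++ u ++ β) / P (wordT α ++ α) := by
  unfold pivotRow
  split_ifs with h
  · simp
  · cases u with
    | nil => exact absurd hβ (by simpa using h)
    | cons y u =>
      rw [coeff_eq_zero_of_mem hlong hβ (y := y) (by simp) (by simpa using h), zero_div]

lemma pivotRow_eq_zero_of_mem
    (hlong : ∀ β, HasType b β → α.length < β.length → RowZero b P β)
    {u β : Word σ} (hβ : HasType b β) {y : σ ⊕ σ} (hy : y ∈ u) (hyb : y.isLeft ≠ b) :
    pivotRow b P α (u ++ β) = 0 := by
  rw [pivotRow_append hlong hβ, coeff_eq_zero_of_mem hlong hβ hy hyb, zero_div]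

lemma pivotRow_self (hP : IsSymmCoeff D P) (hα : HasType b α)
    (hlong : ∀ β, HasType b β → α.length < β.length → RowZero b P β)
    (hc : P (wordT α ++ α) ≠ 0) (u : Word σ) :
    pivotRow b P α (u ++ α) = if u = [] then 1 else 0 := by
  rw [pivotRow_append hlong hα]
  split_ifs with hu
  · simp [hu, hc]
  · rw [coeff_diag_eq_zero hP hα hlong hu, zero_div]

lemma pivotRow_rowZero (hP : IsSymmCoeff D P) (hα : HasType b α)
    (hlong : ∀ β, HasType b β → α.length < β.length → RowZero b P β)
    {β : Word σ} (hβ : HasType b β) (h : RowZero b P β) (u : Word σ) :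
    pivotRow b P α (u ++ β) = 0 := by
  rw [pivotRow_append hlong hβ, hP.apply_eq, h _ _ hα, zero_div]

lemma pivotRow_eq_zero_of_lt (hP : IsSymmCoeff D P) (hα : HasType b α)
    (hlong : ∀ β, HasType b β → α.length < β.length → RowZero b P β)
    {γ : Word σ} (h : α.length < γ.length) : pivotRow b P α γ = 0 := by
  by_cases hγ : HasType b γ
  · simpa using pivotRow_rowZero hP hα hlong hγ (hlong γ hγ h) []
  · exact pivotRow_of_not hγ

/-- Only cuts inside `u` contribute. A cut strictly inside a border word leaves a letter of the
opposite type in front of the other one, where the pivot row vanishes. Hence the correction in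
`eliminate`, defined on bare words, is the Schur complement correction for every factorization `β^T
u γ`. -/
lemma sum_splits_pivotRow
    (hlong : ∀ β, HasType b β → α.length < β.length → RowZero b P β)
    {β γ : Word σ} (hβ : HasType b β) (hγ : HasType b γ) (u : Word σ) :
    ∑ s ∈ splits (wordT β ++ u ++ γ), pivotRow b P α (wordT s.1) * pivotRow b P α s.2 =
      ∑ s ∈ splits u, pivotRow b P α (wordT s.1 ++ β) * pivotRow b P α (s.2 ++ γ) := by
  symm
  refine Finset.sum_of_injOn (fun s => (wordT β ++ s.1, s.2 ++ γ)) ?_ ?_ ?_ ?_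
  · rintro ⟨l, r⟩ _ ⟨l', r'⟩ _ h
    simpa using h
  · rintro ⟨l, r⟩ h
    have h' : l ++ r = u := by simpa using h
    simp [← h']
  · rintro ⟨l, r⟩ h hn
    have h' : l ++ r = wordT β ++ u ++ γ := by simpa using h
    simp only
    rw [List.append_assoc] at h'
    rcases List.append_eq_append_iff.1 h' with ⟨a, h1, h2⟩ | ⟨a, h1, h2⟩
    · -- the cut lies in the left border word
      -- With `a` empty the cut sits exactly between `β^T` and `u`, so it is one of the retained
      -- cuts.
      by_cases ha : a = []
      · subst ha
        exfalso
        refine hn ⟨([], u), by simp, ?_⟩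
        simp_all
      · obtain ⟨y, hy, hyb⟩ : ∃ y ∈ a, y.isLeft ≠ b := by
          have h3 : β = wordT a ++ wordT l := by rw [← wordT_append, ← h1, wordT_wordT]
          have h4 : HasType b (wordT a) := by
            cases hwa : wordT a with
            | nil => exact absurd ((wordT_eq_nil a).1 hwa) ha
            | cons y m => simpa [h3, hwa] using hβ
          simpa using h4.exists_mem_wordT
        rw [h2, ← List.append_assoc, pivotRow_eq_zero_of_mem hlong hγ (y := y)
          (by simp [hy]) hyb, mul_zero]
    · rcases List.append_eq_append_iff.1 h2 with ⟨e, h3, h4⟩ | ⟨e, h3, h4⟩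
      · by_cases he : e = []
        · subst he
          exfalso
          refine hn ⟨(u, []), by simp, ?_⟩
          simp_all
        · obtain ⟨y, hy, hyb⟩ : ∃ y ∈ wordT e, y.isLeft ≠ b := by
            have h5 : HasType b e := by
              cases e with
              | nil => exact absurd rfl he
              | cons y m => simpa [h4] using hγ
            exact h5.exists_mem_wordT
          have : wordT l = (wordT e ++ wordT u) ++ β := by
            rw [h1, h3]; simp
          rw [this, pivotRow_eq_zero_of_mem hlong hβ (y := y) (by simp [hy]) hyb, zero_mul]
      · exfalso
        refine hn ⟨(a, e), by simp [h3], ?_⟩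
        simp [h1, h4]
  · rintro ⟨l, r⟩ _
    simp

lemma eliminate_apply (hlong : ∀ β, HasType b β → α.length < β.length → RowZero b P β)
    {β γ : Word σ} (hβ : HasType b β) (hγ : HasType b γ) (u : Word σ) :
    eliminate b P α (wordT β ++ u ++ γ) = P (wordT β ++ u ++ γ) - P (wordT α ++ α) *
      ∑ s ∈ splits u, pivotRow b P α (wordT s.1 ++ β) * pivotRow b P α (s.2 ++ γ) := by
  rw [eliminate, sum_splits_pivotRow hlong hβ hγ]

/-- The degree bound survives because a nonzero pivot forces `2 * α.length ≤ D`, while the pivot row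
is supported on words no longer than `α`. -/
lemma isSymmCoeff_eliminate (hP : IsSymmCoeff D P) (hα : HasType b α)
    (hlong : ∀ β, HasType b β → α.length < β.length → RowZero b P β) :
    IsSymmCoeff D (eliminate b P α) where
  symm w := by
    unfold eliminate
    rw [hP.symm, sum_splits_wordT (fun l r => pivotRow b P α (wordT l) * pivotRow b P α r)]
    simp only [wordT_wordT, mul_comm]
  eq_zero w hw := by
    unfold eliminate
    rw [hP.eq_zero w hw, zero_sub, neg_eq_zero]
    by_cases hc : P (wordT α ++ α) = 0
    · rw [hc, zero_mul]
    · have h2 : ¬ D < (wordT α ++ α).length := fun h => hc (hP.eq_zero _ h)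
      rw [Finset.sum_eq_zero, mul_zero]
      rintro ⟨l, r⟩ h
      have h' : l ++ r = w := by simpa using h
      rw [← h'] at hw
      simp only [List.length_append, length_wordT] at hw h2
      by_cases hl : α.length < l.length
      · rw [pivotRow_eq_zero_of_lt hP hα hlong (by simpa using hl), zero_mul]
      · rw [pivotRow_eq_zero_of_lt hP hα hlong (γ := r) (by omega), mul_zero]

lemma rowZero_eliminate_self (hP : IsSymmCoeff D P) (hα : HasType b α)
    (hlong : ∀ β, HasType b β → α.length < β.length → RowZero b P β)
    (hc : P (wordT α ++ α) ≠ 0) : RowZero b (eliminate b P α) α := by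
  intro u γ hγ
  rw [eliminate_apply hlong hα hγ, Finset.sum_eq_single ([], u)]
  · rw [pivotRow_append hlong hγ]
    have := pivotRow_self hP hα hlong hc []
    simp only [List.nil_append, if_true] at this
    simp only [wordT_nil, List.nil_append, this]
    field_simp
    simp
  · rintro ⟨l, r⟩ h hne
    have h' : l ++ r = u := by simpa using h
    rw [pivotRow_self hP hα hlong hc, if_neg, zero_mul]
    intro hl
    apply hne
    simp only [wordT_eq_nil] at hl
    simp [← h', hl]
  · simp

/-- By symmetry a vanishing row `β` also gives a zero in the row of `α`, so the correction there is
zero: elimination never refills a cleared row. -/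
lemma rowZero_eliminate (hP : IsSymmCoeff D P) (hα : HasType b α)
    (hlong : ∀ β, HasType b β → α.length < β.length → RowZero b P β)
    {β : Word σ} (hβ : HasType b β) (h : RowZero b P β) :
    RowZero b (eliminate b P α) β := by
  intro u γ hγ
  rw [eliminate_apply hlong hβ hγ, h u γ hγ, Finset.sum_eq_zero]
  · simp
  · intro s _
    rw [pivotRow_rowZero hP hα hlong hβ h, zero_mul]

end Elimination

/-! ### Quadratic forms with values in an arbitrary module -/

section Forms

variable {σ : Type} [Fintype σ] {D : ℕ} {b : Bool} {P : Word σ → ℝ} {α : Word σ}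

/-- The quadratic form with middle matrix given by the coefficients `P`; the value
`K β u γ` stands for the product of `β^T`, `u` and `γ`. -/
def middleForm {M : Type} [AddCommGroup M] [Module ℝ M] (D : ℕ) (P : Word σ → ℝ)
    (K : Word σ → Word σ → Word σ → M) : M :=
  ∑ β ∈ words σ D, ∑ γ ∈ words σ D, ∑ u ∈ words σ D, P (wordT β ++ u ++ γ) • K β u γ

/-- The square of the linear form with coefficients `f`. -/
def squareForm {M : Type} [AddCommGroup M] [Module ℝ M] (D : ℕ) (f : Word σ → ℝ)
    (K : Word σ → Word σ → Word σ → M) : M :=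
  ∑ β ∈ words σ D, ∑ γ ∈ words σ D, ∑ l ∈ words σ D, ∑ r ∈ words σ D,
    (f (l ++ β) * f (r ++ γ)) • K β (wordT l ++ r) γ

/-- Completing the square, as a formal identity. Leaving `K` arbitrary lets it serve both for
numerical values (`evalKernel`) and for polynomials (`polyKernel`). -/
lemma middleForm_eliminate {M : Type} [AddCommGroup M] [Module ℝ M]
    (hP : IsSymmCoeff D P) (hα : HasType b α)
    (hlong : ∀ β, HasType b β → α.length < β.length → RowZero b P β)
    (K : Word σ → Word σ → Word σ → M)
    (hK : ∀ β u γ, ¬ (HasType b β ∧ HasType b γ) → K β u γ = 0) :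
    middleForm D P K = middleForm D (eliminate b P α) K +
      P (wordT α ++ α) • squareForm D (pivotRow b P α) K := by
  unfold middleForm squareForm
  simp only [Finset.smul_sum, ← Finset.sum_add_distrib]
  refine Finset.sum_congr rfl fun β _ => Finset.sum_congr rfl fun γ _ => ?_
  by_cases h : HasType b β ∧ HasType b γ
  swap
  · simp [hK β _ γ h]
  obtain ⟨hβ, hγ⟩ := h
  by_cases hc : P (wordT α ++ α) = 0
  · simp [hc, eliminate]
  have h2 : ¬ D < (wordT α ++ α).length := fun h => hc (hP.eq_zero _ h)
  simp only [List.length_append, length_wordT] at h2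
  -- If `l` and `r` together exceed `D ≥ 2 * α.length`, one pivot row entry has an argument longer
  -- than `α` and vanishes.
  have key := sum_words_splits D (fun l r => (pivotRow b P α (wordT l ++ β) *
    pivotRow b P α (r ++ γ)) • K β (l ++ r) γ) (by
      intro l r hlr
      by_cases hl : α.length < (wordT l ++ β).length
      · rw [pivotRow_eq_zero_of_lt hP hα hlong hl, zero_mul, zero_smul]
      · rw [pivotRow_eq_zero_of_lt hP hα hlong (γ := r ++ γ), mul_zero, zero_smul]
        simp at hl ⊢
        omega)
  rw [← sum_words_wordT D fun l => ∑ r ∈ words σ D, (pivotRow b P α (wordT l ++ β) *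
    pivotRow b P α (r ++ γ)) • K β (l ++ r) γ] at key
  simp only [wordT_wordT] at key
  rw [Finset.sum_add_distrib]
  simp only [← Finset.smul_sum]
  rw [← key, Finset.smul_sum, ← Finset.sum_add_distrib]
  refine Finset.sum_congr rfl fun u _ => ?_
  have hs : ∑ s ∈ splits u, (pivotRow b P α (wordT s.1 ++ β) * pivotRow b P α (s.2 ++ γ)) •
      K β (s.1 ++ s.2) γ = ∑ s ∈ splits u,
        (pivotRow b P α (wordT s.1 ++ β) * pivotRow b P α (s.2 ++ γ)) • K β u γ :=
    Finset.sum_congr rfl fun s hs => by rw [mem_splits.1 hs]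
  rw [eliminate_apply hlong hβ hγ, sub_smul, mul_smul, Finset.sum_smul, hs, sub_add_cancel]

end Forms

/-! ### Evaluation of words and dual families -/

section Evaluation

variable {σ : Type} {n : Type} [Fintype n] [DecidableEq n] {R : Type} [CommRing R]

/-- The value of a word at a tuple of matrices. -/
def wordEval (X : σ → Matrix n n R) (w : Word σ) : Matrix n n R :=
  (w.map (Sum.elim X fun s => (X s)ᵀ)).prod

@[simp] lemma wordEval_nil (X : σ → Matrix n n R) : wordEval X [] = 1 := by simp [wordEval]

lemma wordEval_cons (X : σ → Matrix n n R) (a : σ ⊕ σ) (w : Word σ) :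
    wordEval X (a :: w) = Sum.elim X (fun s => (X s)ᵀ) a * wordEval X w := by simp [wordEval]

lemma wordEval_append (X : σ → Matrix n n R) (u v : Word σ) :
    wordEval X (u ++ v) = wordEval X u * wordEval X v := by simp [wordEval]

lemma wordEval_wordT (X : σ → Matrix n n R) (w : Word σ) :
    wordEval X (wordT w) = (wordEval X w)ᵀ := by
  induction w with
  | nil => simp
  | cons a w ih =>
    rw [wordT_cons, wordEval_append, ih, wordEval_cons, wordEval_cons, Matrix.transpose_mul]
    cases a <;> simp

/-- The vectors `m(X) v` for words `m` of length at most `D` are linearly independent; `μ` is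
a dual family. -/
def IsDualFamily (D : ℕ) (X : σ → Matrix n n ℝ) (v : n → ℝ) (μ : Word σ → n → ℝ) : Prop :=
  ∀ l m : Word σ, l.length ≤ D → m.length ≤ D →
    (l = m → μ l ⬝ᵥ (wordEval X m *ᵥ v) = 1) ∧ (l ≠ m → μ l ⬝ᵥ (wordEval X m *ᵥ v) = 0)

lemma IsDualFamily.dotProduct_pos {D : ℕ} {X : σ → Matrix n n ℝ} {v : n → ℝ} {μ : Word σ → n → ℝ}
    (h : IsDualFamily D X v μ) : 0 < v ⬝ᵥ v := by
  refine lt_of_le_of_ne (Finset.sum_nonneg fun i _ => mul_self_nonneg _) fun h0 => ?_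
  have := (h [] [] (by simp) (by simp)).1 rfl
  rw [dotProduct_self_eq_zero.1 h0.symm] at this
  simp at this

end Evaluation

open Classical in
lemma single_eq_zero_of_not {σ n : Type} {b : Bool} {α : Word σ} (hα : HasType b α) (ζ : n → ℝ) {β : Word σ}
    (hβ : ¬ HasType b β) : (Pi.single α ζ : Word σ → n → ℝ) β = 0 :=
  Pi.single_eq_of_ne (fun h : β = α => hβ (h ▸ hα)) _


/-! ### Positivity at one point and its behaviour under elimination -/

section Positivity

variable {σ : Type} [Fintype σ] {D : ℕ} {b : Bool} {P : Word σ → ℝ} {α : Word σ}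
  {n : Type} [Fintype n] [DecidableEq n] {X : σ → Matrix n n ℝ}

/-- The values `z β ⬝ᵥ u(X) z' γ`, where the vectors `z β` and `z' γ` take the place of
the border monomials. -/
def evalKernel (X : σ → Matrix n n ℝ) (z z' : Word σ → n → ℝ) (β u γ : Word σ) : ℝ :=
  z β ⬝ᵥ (wordEval X u *ᵥ z' γ)

/-- The middle matrix of type `b` with the coefficients `P` is positive semidefinite at `X`. -/
def IsPosAt (D : ℕ) (b : Bool) (X : σ → Matrix n n ℝ) (P : Word σ → ℝ) : Prop :=
  ∀ z : Word σ → n → ℝ, (∀ β, ¬ HasType b β → z β = 0) →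
    0 ≤ middleForm D P (evalKernel X z z)

/-- Pairing the relation, applied to `v`, with `μ w` isolates `r w`. This turns matrix identities at
`X` into identities of coefficients. -/
lemma IsDualFamily.coeff_eq_zero {v : n → ℝ} {μ : Word σ → n → ℝ} (h : IsDualFamily D X v μ)
    (r : Word σ → ℝ) (hr : ∑ u ∈ words σ D, r u • wordEval X u = 0) {w : Word σ}
    (hw : w.length ≤ D) : r w = 0 := by
  have h1 : μ w ⬝ᵥ ((∑ u ∈ words σ D, r u • wordEval X u) *ᵥ v) = r w := by
    rw [Matrix.sum_mulVec, dotProduct_sum, Finset.sum_eq_single w]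
    · rw [Matrix.smul_mulVec, dotProduct_smul, (h w w hw hw).1 rfl, smul_eq_mul, mul_one]
    · intro u hu hne
      rw [Matrix.smul_mulVec, dotProduct_smul, (h w u hw (by simpa using hu)).2 hne.symm,
        smul_zero]
    · simp [hw]
  rw [← h1, hr, Matrix.zero_mulVec, dotProduct_zero]

lemma middleForm_add_left (z₁ z₂ z' : Word σ → n → ℝ) :
    middleForm D P (evalKernel X (z₁ + z₂) z') =
      middleForm D P (evalKernel X z₁ z') + middleForm D P (evalKernel X z₂ z') := by
  simp [middleForm, evalKernel, add_dotProduct, mul_add, Finset.sum_add_distrib]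

lemma middleForm_add_right (z z₁ z₂ : Word σ → n → ℝ) :
    middleForm D P (evalKernel X z (z₁ + z₂)) =
      middleForm D P (evalKernel X z z₁) + middleForm D P (evalKernel X z z₂) := by
  simp [middleForm, evalKernel, Matrix.mulVec_add, dotProduct_add, mul_add,
    Finset.sum_add_distrib]

lemma middleForm_smul_left (s : ℝ) (z z' : Word σ → n → ℝ) :
    middleForm D P (evalKernel X (s • z) z') = s * middleForm D P (evalKernel X z z') := by
  simp [middleForm, evalKernel, smul_dotProduct, Finset.mul_sum, mul_left_comm]

lemma middleForm_smul_right (s : ℝ) (z z' : Word σ → n → ℝ) :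
    middleForm D P (evalKernel X z (s • z')) = s * middleForm D P (evalKernel X z z') := by
  simp [middleForm, evalKernel, Matrix.mulVec_smul, dotProduct_smul, Finset.mul_sum,
    mul_left_comm]

lemma middleForm_comm (hP : IsSymmCoeff D P) (z z' : Word σ → n → ℝ) :
    middleForm D P (evalKernel X z z') = middleForm D P (evalKernel X z' z) := by
  unfold middleForm
  rw [Finset.sum_comm]
  refine Finset.sum_congr rfl fun β _ => Finset.sum_congr rfl fun γ _ => ?_
  rw [← sum_words_wordT]
  refine Finset.sum_congr rfl fun u _ => ?_
  rw [hP.apply_eq, wordT_wordT]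
  unfold evalKernel
  rw [wordEval_wordT, Matrix.mulVec_transpose, dotProduct_comm, ← Matrix.dotProduct_mulVec]

open Classical in
lemma middleForm_single {β γ : Word σ} (hβ : β.length ≤ D) (hγ : γ.length ≤ D)
    (ζ η : n → ℝ) :
    middleForm D P (evalKernel X (Pi.single β ζ) (Pi.single γ η)) =
      ζ ⬝ᵥ ((∑ u ∈ words σ D, P (wordT β ++ u ++ γ) • wordEval X u) *ᵥ η) := by
  unfold middleForm evalKernel
  rw [Finset.sum_eq_single β, Finset.sum_eq_single γ]
  · simp [Matrix.sum_mulVec, dotProduct_sum, Matrix.smul_mulVec]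
  · intro γ' _ h
    simp [Pi.single_eq_of_ne h]
  · simp [hγ]
  · intro β' _ h
    simp [Pi.single_eq_of_ne h]
  · simp [hβ]

open Classical in
lemma middleForm_single_self (hP : IsSymmCoeff D P) (hα : HasType b α) (hD : α.length ≤ D)
    (hlong : ∀ β, HasType b β → α.length < β.length → RowZero b P β) (ζ : n → ℝ) :
    middleForm D P (evalKernel X (Pi.single α ζ) (Pi.single α ζ)) =
      P (wordT α ++ α) * (ζ ⬝ᵥ ζ) := by
  rw [middleForm_single hD hD, Finset.sum_eq_single []]
  · simp [Matrix.smul_mulVec, dotProduct_smul]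
  · intro u _ hu
    rw [coeff_diag_eq_zero hP hα hlong hu, zero_smul]
  · simp

lemma coeff_diag_nonneg {v : n → ℝ} {μ : Word σ → n → ℝ} (hX : IsDualFamily D X v μ)
    (hP : IsSymmCoeff D P) (hpos : IsPosAt D b X P) (hα : HasType b α) (hD : α.length ≤ D)
    (hlong : ∀ β, HasType b β → α.length < β.length → RowZero b P β) :
    0 ≤ P (wordT α ++ α) := by
  classical
  have := hpos (Pi.single α v) fun β => single_eq_zero_of_not hα v
  rw [middleForm_single_self hP hα hD hlong] at this
  exact nonneg_of_mul_nonneg_left this hX.dotProduct_pos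

lemma eq_zero_of_forall_nonneg {x y : ℝ} (h : ∀ s : ℝ, 0 ≤ 2 * s * x + y) : x = 0 := by
  by_contra hx
  -- This `s` makes the expression equal to `-1`.
  have := h (-(y + 1) / (2 * x))
  field_simp at this
  linarith

/-- In a positive semidefinite form a zero diagonal entry kills its row: scaling the `α` component
by `s` makes the form affine in `s`, so the cross term vanishes for all vectors, and `coeff_eq_zero`
descends to coefficients. -/
lemma rowZero_of_coeff_diag {v : n → ℝ} {μ : Word σ → n → ℝ} (hX : IsDualFamily D X v μ)
    (hP : IsSymmCoeff D P) (hpos : IsPosAt D b X P) (hα : HasType b α) (hD : α.length ≤ D)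
    (hlong : ∀ β, HasType b β → α.length < β.length → RowZero b P β)
    (hc : P (wordT α ++ α) = 0) : RowZero b P α := by
  classical
  intro u γ hγ
  by_cases hγD : D < γ.length
  · exact hP.eq_zero _ (by simp; omega)
  by_cases huD : D < u.length
  · exact hP.eq_zero _ (by simp; omega)
  refine hX.coeff_eq_zero (fun u => P (wordT α ++ u ++ γ)) ?_ (not_lt.1 huD)
  refine Matrix.ext_of_mulVec_single fun i => ?_
  rw [Matrix.zero_mulVec]
  refine dotProduct_eq_zero _ fun ζ => ?_
  generalize (Pi.single i 1 : n → ℝ) = η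
  rw [dotProduct_comm, ← middleForm_single hD (not_lt.1 hγD)]
  refine eq_zero_of_forall_nonneg (y := middleForm D P
    (evalKernel X (Pi.single γ η) (Pi.single γ η))) fun s => ?_
  have := hpos (s • (Pi.single α ζ : Word σ → n → ℝ) + (Pi.single γ η : Word σ → n → ℝ))
    fun β hβ => by
      rw [Pi.add_apply, Pi.smul_apply, single_eq_zero_of_not hα _ hβ,
        single_eq_zero_of_not hγ _ hβ, smul_zero, zero_add]
  simp only [middleForm_add_left, middleForm_add_right, middleForm_smul_left,
    middleForm_smul_right, middleForm_single_self hP hα hD hlong, hc] at this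
  rw [middleForm_comm hP (Pi.single γ _) (Pi.single α ζ)] at this
  linarith

/-- The value of the linear form with coefficients `f`. -/
def linearValue (D : ℕ) (X : σ → Matrix n n ℝ) (f : Word σ → ℝ) (z : Word σ → n → ℝ) :
    n → ℝ :=
  ∑ β ∈ words σ D, ∑ u ∈ words σ D, f (u ++ β) • (wordEval X u *ᵥ z β)

lemma squareForm_eval (f : Word σ → ℝ) (z : Word σ → n → ℝ) :
    squareForm D f (evalKernel X z z) = linearValue D X f z ⬝ᵥ linearValue D X f z := by
  unfold squareForm linearValue
  rw [sum_dotProduct]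
  refine Finset.sum_congr rfl fun β _ => ?_
  rw [Finset.sum_comm, sum_dotProduct]
  refine Finset.sum_congr rfl fun l _ => ?_
  rw [dotProduct_sum]
  refine Finset.sum_congr rfl fun γ _ => ?_
  rw [dotProduct_sum]
  refine Finset.sum_congr rfl fun r _ => ?_
  rw [smul_dotProduct, dotProduct_smul, smul_smul]
  congr 1
  unfold evalKernel
  rw [wordEval_append, wordEval_wordT, ← Matrix.mulVec_mulVec, Matrix.dotProduct_mulVec,
    Matrix.vecMul_transpose]

/-- The Schur complement does not see the component at `α`, so that component may be chosen to make
the eliminated square vanish; there the old and new forms agree. -/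
lemma isPosAt_eliminate (hP : IsSymmCoeff D P) (hpos : IsPosAt D b X P) (hα : HasType b α)
    (hD : α.length ≤ D)
    (hlong : ∀ β, HasType b β → α.length < β.length → RowZero b P β)
    (hc : P (wordT α ++ α) ≠ 0) : IsPosAt D b X (eliminate b P α) := by
  classical
  intro z hz
  set y := linearValue D X (pivotRow b P α) z with hy
  -- The pivot row is `1` at `α` and `0` at `u ++ α` for nonempty `u`, so this shift lowers the
  -- linear form by exactly `y`.
  set z' := z - Pi.single α y with hz'
  have hz'0 : ∀ β, ¬ HasType b β → z' β = 0 := fun β hβ => by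
    rw [hz', Pi.sub_apply, hz β hβ, single_eq_zero_of_not hα _ hβ, sub_zero]
  have hlin : linearValue D X (pivotRow b P α) z' = 0 := by
    have : linearValue D X (pivotRow b P α) (Pi.single α y) = y := by
      unfold linearValue
      rw [Finset.sum_eq_single α, Finset.sum_eq_single []]
      · rw [pivotRow_self hP hα hlong hc]
        simp
      · intro u _ hu
        rw [pivotRow_self hP hα hlong hc, if_neg hu, zero_smul]
      · simp
      · intro β _ h
        simp [Pi.single_eq_of_ne h]
      · simp [hD]
    have h2 : ∀ f, linearValue D X f z' =
        linearValue D X f z - linearValue D X f (Pi.single α y) := by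
      intro f
      simp [linearValue, hz', Matrix.mulVec_sub, smul_sub, Finset.sum_sub_distrib]
    rw [h2, this, ← hy, sub_self]
  have h0 := hpos z' hz'0
  have hker : ∀ w : Word σ → n → ℝ, (∀ β, ¬ HasType b β → w β = 0) →
      ∀ β u γ, ¬ (HasType b β ∧ HasType b γ) → evalKernel X w w β u γ = 0 := by
    intro w hw β u γ h
    unfold evalKernel
    by_cases hβ : HasType b β
    · rw [hw γ fun hγ => h ⟨hβ, hγ⟩]
      simp
    · rw [hw β hβ]
      simp
  rw [middleForm_eliminate hP hα hlong _ (hker z' hz'0), squareForm_eval, hlin,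
    dotProduct_zero, smul_zero, add_zero] at h0
  refine h0.trans_eq ?_
  unfold middleForm
  refine Finset.sum_congr rfl fun β _ => Finset.sum_congr rfl fun γ _ =>
    Finset.sum_congr rfl fun u _ => ?_
  by_cases hβγ : HasType b β ∧ HasType b γ
  swap
  · rw [hker z' hz'0 _ _ _ hβγ, hker z hz _ _ _ hβγ]
  obtain ⟨hβ, hγ⟩ := hβγ
  have hrow := rowZero_eliminate_self hP hα hlong hc
  by_cases h1 : β = α
  · rw [h1, hrow u γ hγ, zero_smul, zero_smul]
  by_cases h2 : γ = α
  · rw [(isSymmCoeff_eliminate hP hα hlong).apply_eq, h2, hrow _ β hβ, zero_smul, zero_smul]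
  simp [evalKernel, hz', Pi.single_eq_of_ne h1, Pi.single_eq_of_ne h2]

end Positivity

/-! ### Full elimination into a triangular sum of squares -/

section SumOfSquares

variable {σ : Type} [Fintype σ] {D : ℕ} {b : Bool} {n : Type} [Fintype n] [DecidableEq n]
  {X : σ → Matrix n n ℝ}

/-- The elimination can be carried out along an enumeration `V` of the border words by
decreasing length, from the index `k` on if the rows before `k` vanish. -/
lemma exists_squares_aux {v : n → ℝ} {μ : Word σ → n → ℝ} (hX : IsDualFamily D X v μ)
    {N : ℕ} (V : Fin N → Word σ) (hlen : ∀ i j, i ≤ j → (V j).length ≤ (V i).length)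
    (hD : ∀ i, (V i).length ≤ D)
    (hV : ∀ β, HasType b β → β.length ≤ D → ∃ i, V i = β) (m : ℕ) :
    ∀ (k : ℕ), k + m = N → ∀ P : Word σ → ℝ, IsSymmCoeff D P → IsPosAt D b X P →
      (∀ i : Fin N, i.val < k → HasType b (V i) → RowZero b P (V i)) →
      ∃ (d : Fin N → ℝ) (f : Fin N → Word σ → ℝ),
        (∀ i, 0 ≤ d i) ∧ (∀ i : Fin N, i.val < k → d i = 0) ∧
        (∀ i, d i ≠ 0 → HasType b (V i) ∧ (∀ u, f i (u ++ V i) = if u = [] then 1 else 0) ∧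
          ∀ j, j < i → HasType b (V j) → ∀ u, f i (u ++ V j) = 0) ∧
        ∀ (M : Type) [AddCommGroup M] [Module ℝ M] (K : Word σ → Word σ → Word σ → M),
          (∀ β u γ, ¬ (HasType b β ∧ HasType b γ) → K β u γ = 0) →
          middleForm D P K = ∑ i, d i • squareForm D (f i) K := by
  induction m with
  | zero =>
    intro k hk P hP hpos hrow
    refine ⟨0, 0, by simp, by simp, by simp, fun M _ _ K hK => ?_⟩
    simp only [Pi.zero_apply, zero_smul, Finset.sum_const_zero]
    refine Finset.sum_eq_zero fun β hβ => Finset.sum_eq_zero fun γ _ =>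
      Finset.sum_eq_zero fun u _ => ?_
    by_cases h : HasType b β ∧ HasType b γ
    · obtain ⟨i, rfl⟩ := hV β h.1 (by simpa using hβ)
      rw [hrow i (by omega) h.1 u γ h.2, zero_smul]
    · rw [hK _ _ _ h, smul_zero]
  | succ m ih =>
    intro k hk P hP hpos hrow
    set k' : Fin N := ⟨k, by omega⟩ with hk'
    -- An index of the other type or with a vanishing row is skipped and keeps weight zero.
    by_cases hzero : HasType b (V k') → RowZero b P (V k')
    · obtain ⟨d, f, h1, h2, h3⟩ := ih (k + 1) (by omega) P hP hpos fun i hi => by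
        rcases Nat.lt_succ_iff_lt_or_eq.1 hi with h | h
        · exact hrow i h
        · rwa [show i = k' from Fin.ext h]
      exact ⟨d, f, h1, fun i hi => h2 i (by omega), h3⟩
    push Not at hzero
    obtain ⟨hα, hne⟩ := hzero
    have hlong : ∀ β, HasType b β → (V k').length < β.length → RowZero b P β := by
      intro β hβ hlt
      by_cases hβD : D < β.length
      · exact hP.rowZero_of_lt hβD
      · obtain ⟨i, rfl⟩ := hV β hβ (not_lt.1 hβD)
        refine hrow i ?_ hβ
        by_contra h
        exact absurd (hlen k' i (not_lt.1 h)) (not_le.2 hlt)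
    have hc : P (wordT (V k') ++ V k') ≠ 0 := fun hc =>
      hne (rowZero_of_coeff_diag hX hP hpos hα (hD k') hlong hc)
    obtain ⟨d, f, h1, h2, h3, h4⟩ := ih (k + 1) (by omega) (eliminate b P (V k'))
      (isSymmCoeff_eliminate hP hα hlong) (isPosAt_eliminate hP hpos hα (hD k') hlong hc)
      fun i hi hi' => by
        rcases Nat.lt_succ_iff_lt_or_eq.1 hi with h | h
        · exact rowZero_eliminate hP hα hlong hi' (hrow i h hi')
        · rw [show i = k' from Fin.ext h]
          exact rowZero_eliminate_self hP hα hlong hc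
    -- The later steps left weight zero at `k'`; the new pivot and its row go into that free slot.
    refine ⟨Function.update d k' (P (wordT (V k') ++ V k')),
      Function.update f k' (pivotRow b P (V k')), fun i => ?_, fun i hi => ?_, fun i hi => ?_,
      fun M _ _ K hK => ?_⟩
    · by_cases h : i = k'
      · subst h
        simpa using coeff_diag_nonneg hX hP hpos hα (hD k') hlong
      · simpa [h] using h1 i
    · rw [Function.update_of_ne (by rintro rfl; simp [hk'] at hi)]
      exact h2 i (by omega)
    · by_cases h : i = k'
      · subst h
        simp only [Function.update_self]
        exact ⟨hα, pivotRow_self hP hα hlong hc, fun j hj hj' u =>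
          pivotRow_rowZero hP hα hlong hj' (hrow j hj hj') u⟩
      · simp only [Function.update_of_ne h] at hi ⊢
        exact h3 i hi
    · rw [middleForm_eliminate hP hα hlong K hK, h4 M K hK, ← Finset.add_sum_erase _ _
        (Finset.mem_univ k'), ← Finset.add_sum_erase (a := k') _ (fun i => Function.update d k' _ i • _)
        (Finset.mem_univ k'), h2 k' (by simp [hk'])]
      simp only [Function.update_self, zero_smul, zero_add]
      rw [add_comm]
      congr 1
      refine Finset.sum_congr rfl fun i hi => ?_
      have := Finset.ne_of_mem_erase hi
      rw [Function.update_of_ne this, Function.update_of_ne this]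

/-- A positive semidefinite middle matrix is a weighted sum of squares, triangular with respect
to an enumeration `V` of the border words by decreasing length. -/
lemma exists_squares {v : n → ℝ} {μ : Word σ → n → ℝ} (hX : IsDualFamily D X v μ)
    {N : ℕ} (V : Fin N → Word σ) (hlen : ∀ i j, i ≤ j → (V j).length ≤ (V i).length)
    (hD : ∀ i, (V i).length ≤ D)
    (hV : ∀ β, HasType b β → β.length ≤ D → ∃ i, V i = β)
    {P : Word σ → ℝ} (hP : IsSymmCoeff D P) (hpos : IsPosAt D b X P) :
    ∃ (d : Fin N → ℝ) (f : Fin N → Word σ → ℝ),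
      (∀ i, 0 ≤ d i) ∧
      (∀ i, d i ≠ 0 → HasType b (V i) ∧ (∀ u, f i (u ++ V i) = if u = [] then 1 else 0) ∧
        ∀ j, j < i → HasType b (V j) → ∀ u, f i (u ++ V j) = 0) ∧
      ∀ (M : Type) [AddCommGroup M] [Module ℝ M] (K : Word σ → Word σ → Word σ → M),
        (∀ β u γ, ¬ (HasType b β ∧ HasType b γ) → K β u γ = 0) →
        middleForm D P K = ∑ i, d i • squareForm D (f i) K := by
  obtain ⟨d, f, h1, -, h3⟩ := exists_squares_aux hX V hlen hD hV N 0 (zero_add N) P hP hpos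
    (by simp)
  exact ⟨d, f, h1, h3⟩

/-- An enumeration of the nonempty words of length at most `D` by decreasing length. -/
lemma exists_enumeration (σ : Type) [Fintype σ] (D : ℕ) :
    ∃ (N : ℕ) (V : Fin N → Word σ), Function.Injective V ∧
      (∀ i j, i ≤ j → (V j).length ≤ (V i).length) ∧ (∀ i, (V i).length ≤ D) ∧
      (∀ i, V i ≠ []) ∧ ∀ β, β ≠ [] → β.length ≤ D → ∃ i, V i = β := by
  classical
  set S := (words σ D).erase [] with hS
  have hmem : ∀ w, w ∈ S ↔ w ≠ [] ∧ w.length ≤ D := by simp [hS]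
  let e : Fin S.card ≃ S := S.equivFin.symm
  let key : Fin S.card → ℕᵒᵈ := fun i => OrderDual.toDual (e i).1.length
  refine ⟨S.card, fun i => (e (Tuple.sort key i)).1, ?_, ?_, ?_, ?_, ?_⟩
  · exact Subtype.val_injective.comp (e.injective.comp (Tuple.sort key).injective)
  · exact fun i j hij => Tuple.monotone_sort key hij
  · exact fun i => ((hmem _).1 (e _).2).2
  · exact fun i => ((hmem _).1 (e _).2).1
  · intro β hβ hβD
    refine ⟨(Tuple.sort key).symm (e.symm ⟨β, (hmem β).2 ⟨hβ, hβD⟩⟩), ?_⟩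
    simp

end SumOfSquares

/-! ### The involution and monomial expansions -/

section Transpose

variable {σ : Type}

lemma transpose_eq (p : NCPoly σ) :
    transpose p = ((MulOpposite.opLinearEquiv ℝ).symm.toLinearMap ∘ₗ
      (transposeHom σ).toLinearMap) p := rfl

@[simp] lemma transpose_zero : transpose (0 : NCPoly σ) = 0 := by simp [transpose]

lemma transpose_add (p q : NCPoly σ) : transpose (p + q) = transpose p + transpose q := by
  simp [transpose]

lemma transpose_smul (c : ℝ) (p : NCPoly σ) : transpose (c • p) = c • transpose p := by
  simp [transpose]

lemma transpose_mul (p q : NCPoly σ) : transpose (p * q) = transpose q * transpose p := by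
  simp [transpose]

@[simp] lemma transpose_one : transpose (1 : NCPoly σ) = 1 := by simp [transpose]

lemma transpose_sum {ι : Type} (s : Finset ι) (f : ι → NCPoly σ) :
    transpose (∑ i ∈ s, f i) = ∑ i ∈ s, transpose (f i) := by
  simp only [transpose_eq, map_sum]

@[simp] lemma transpose_ι (v : σ ⊕ σ) :
    transpose (FreeAlgebra.ι ℝ v) = FreeAlgebra.ι ℝ v.swap := by
  simp [transpose, transposeHom]

lemma eval_transpose {n : Type} [Fintype n] [DecidableEq n] (X : σ → Matrix n n ℝ)
    (p : NCPoly σ) : eval X (transpose p) = (eval X p)ᵀ := by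
  induction p using FreeAlgebra.induction with
  | grade0 r => simp [transpose, Matrix.algebraMap_eq_diagonal]
  | grade1 v => cases v <;> simp [eval]
  | mul a b ha hb => rw [transpose_mul, map_mul, map_mul, ha, hb, Matrix.transpose_mul]
  | add a b ha hb => rw [transpose_add, map_add, map_add, ha, hb, Matrix.transpose_add]

lemma eval_reindex {m n : Type} [Fintype m] [DecidableEq m] [Fintype n] [DecidableEq n]
    (e : m ≃ n) (X : σ → Matrix m m ℝ) (p : NCPoly σ) :
    eval (fun s => Matrix.reindex e e (X s)) p = Matrix.reindex e e (eval X p) := by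
  have : eval (fun s => Matrix.reindex e e (X s)) =
      (Matrix.reindexAlgEquiv ℝ ℝ e).toAlgHom.comp (eval X) := by
    refine FreeAlgebra.hom_ext (funext fun v => ?_)
    cases v <;> simp [eval]
  rw [this]
  rfl

/-- The monomial of a word. -/
def monomial (w : Word σ) : NCPoly σ := (w.map (FreeAlgebra.ι ℝ)).prod

@[simp] lemma monomial_nil : monomial ([] : Word σ) = 1 := rfl

lemma monomial_cons (a : σ ⊕ σ) (w : Word σ) :
    monomial (a :: w) = FreeAlgebra.ι ℝ a * monomial w := by simp [monomial]

lemma monomial_append (u v : Word σ) : monomial (u ++ v) = monomial u * monomial v := by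
  simp [monomial]

lemma transpose_monomial (w : Word σ) : transpose (monomial w) = monomial (wordT w) := by
  induction w with
  | nil => simp
  | cons a w ih =>
    rw [monomial_cons, transpose_mul, ih, wordT_cons, monomial_append]
    simp [monomial]

lemma mem_span_monomial (p : NCPoly σ) :
    p ∈ Submodule.span ℝ (Set.range (monomial : Word σ → NCPoly σ)) := by
  induction p using FreeAlgebra.induction with
  | grade0 r =>
    rw [Algebra.algebraMap_eq_smul_one]
    exact Submodule.smul_mem _ _ (Submodule.subset_span ⟨[], rfl⟩)
  | grade1 v => exact Submodule.subset_span ⟨[v], by simp [monomial]⟩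
  | mul a b ha hb =>
    have h := Submodule.mul_mem_mul ha hb
    rw [Submodule.span_mul_span] at h
    refine Submodule.span_mono ?_ h
    rintro _ ⟨_, ⟨u, rfl⟩, _, ⟨v, rfl⟩, rfl⟩
    exact ⟨u ++ v, monomial_append u v⟩
  | add a b ha hb => exact Submodule.add_mem _ ha hb

lemma exists_coeff [Fintype σ] (p : NCPoly σ) :
    ∃ (D : ℕ) (P : Word σ → ℝ), (∀ w, D < w.length → P w = 0) ∧
      p = ∑ w ∈ words σ D, P w • monomial w := by
  obtain ⟨c, hc⟩ := Finsupp.mem_span_range_iff_exists_finsupp.1 (mem_span_monomial p)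
  have hD : ∀ w, c.support.sup List.length < w.length → c w = 0 := fun w hw => by
    by_contra h
    exact absurd (Finset.le_sup (f := List.length) (Finsupp.mem_support_iff.2 h))
      (not_le.2 hw)
  refine ⟨c.support.sup List.length, c, hD, ?_⟩
  rw [← hc]
  refine Finset.sum_subset (fun w hw => ?_) (fun w _ hw => ?_)
  · exact mem_words.2 (Finset.le_sup (f := List.length) hw)
  · simp [Finsupp.notMem_support_iff.1 hw]

lemma IsSymmetric.exists_coeff [Fintype σ] {p : NCPoly σ} (hp : IsSymmetric p) :
    ∃ (D : ℕ) (P : Word σ → ℝ), IsSymmCoeff D P ∧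
      p = ∑ w ∈ words σ D, P w • monomial w := by
  obtain ⟨D, P, hP, h⟩ := NCPlush.exists_coeff p
  -- Averaging with the transpose makes the coefficients symmetric without appealing to their
  -- uniqueness.
  refine ⟨D, fun w => (P w + P (wordT w)) / 2, ⟨fun w => ?_, fun w hw => ?_⟩, ?_⟩
  · rw [wordT_wordT, add_comm]
  · simp [hP w hw, hP (wordT w) (by simpa using hw)]
  · have h2 : p = ∑ w ∈ words σ D, P (wordT w) • monomial w := by
      rw [← sum_words_wordT]
      simp only [wordT_wordT]
      conv_lhs => rw [← hp, h, transpose_sum]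
      simp only [transpose_smul, transpose_monomial]
    have h3 : p = (1 / 2 : ℝ) • (p + p) := by
      rw [← two_smul ℝ p, smul_smul]; norm_num
    rw [h3]
    nth_rw 1 [h]
    rw [h2, ← Finset.sum_add_distrib, Finset.smul_sum]
    refine Finset.sum_congr rfl fun w _ => ?_
    rw [← add_smul, smul_smul]
    congr 1
    ring

end Transpose

/-! ### The complex hessian as two middle forms -/

section HessianExpansion

variable {g : ℕ}

/-- The monomial of a word in `x, x^T` as a polynomial in `x, x^T, h, h^T`. -/
def xMonomial (w : Word (Fin g)) : NCPoly (Fin g ⊕ Fin g) := (w.map (Sum.elim xv xvT)).prod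

/-- The monomial of a word with its first letter changed from `x_j` to `h_j` or from `x_j^T` to
`h_j^T`. It is zero unless the word has type `b`. -/
def border (b : Bool) : Word (Fin g) → NCPoly (Fin g ⊕ Fin g)
  | [] => 0
  | a :: m => if a.isLeft = b then Sum.elim hv hvT a * xMonomial m else 0

@[simp] lemma border_nil (b : Bool) : border b ([] : Word (Fin g)) = 0 := rfl

lemma border_of_not {b : Bool} {β : Word (Fin g)} (h : ¬ HasType b β) : border b β = 0 := by
  cases β with
  | nil => rfl
  | cons a m => exact if_neg (by simpa using h)

@[simp] lemma xMonomial_nil : xMonomial ([] : Word (Fin g)) = 1 := rfl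

lemma xMonomial_cons (a : Fin g ⊕ Fin g) (w : Word (Fin g)) :
    xMonomial (a :: w) = Sum.elim xv xvT a * xMonomial w := by simp [xMonomial]

lemma xMonomial_append (u v : Word (Fin g)) :
    xMonomial (u ++ v) = xMonomial u * xMonomial v := by simp [xMonomial]

lemma transpose_xLetter (a : Fin g ⊕ Fin g) :
    transpose (Sum.elim xv xvT a : NCPoly (Fin g ⊕ Fin g)) = Sum.elim xv xvT a.swap := by
  cases a <;> simp [xv, xvT, var, varT]

lemma transpose_xMonomial (w : Word (Fin g)) :
    transpose (xMonomial w) = xMonomial (wordT w) := by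
  induction w with
  | nil => simp
  | cons a w ih =>
    rw [xMonomial_cons, transpose_mul, ih, wordT_cons, xMonomial_append, transpose_xLetter]
    simp [xMonomial]

lemma embed_monomial (w : Word (Fin g)) : embed g (monomial w) = xMonomial w := by
  simp [monomial, xMonomial, map_list_prod, embed, Function.comp_def]

/-- The derivative of a word with respect to `x` in direction `h` if `b` is true, with respect
to `x^T` in direction `h^T` if `b` is false. -/
def wordDeriv (b : Bool) (w : Word (Fin g)) : NCPoly (Fin g ⊕ Fin g) :=
  ∑ s ∈ splits w, xMonomial s.1 * border b s.2

/-- The part of the hessian of a word in which the second of the two directions has type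
`b`. -/
def wordHessian (b : Bool) (w : Word (Fin g)) : NCPoly (Fin g ⊕ Fin g) :=
  ∑ s ∈ splits w, transpose (border b (wordT s.1)) * wordDeriv b s.2

lemma wordDeriv_nil (b : Bool) : wordDeriv b ([] : Word (Fin g)) = 0 := by
  rw [wordDeriv, sum_splits_nil (fun l r => xMonomial l * border b r)]
  simp

lemma wordDeriv_cons (b : Bool) (a : Fin g ⊕ Fin g) (w : Word (Fin g)) :
    wordDeriv b (a :: w) =
      (if a.isLeft = b then Sum.elim hv hvT a * xMonomial w else 0) +
        Sum.elim xv xvT a * wordDeriv b w := by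
  rw [wordDeriv, sum_splits_cons (fun l r => xMonomial l * border b r), wordDeriv,
    Finset.mul_sum]
  simp [xMonomial_cons, border, mul_assoc]

lemma wordHessian_nil (b : Bool) : wordHessian b ([] : Word (Fin g)) = 0 := by
  rw [wordHessian, sum_splits_nil (fun l r => transpose (border b (wordT l)) * wordDeriv b r)]
  simp

lemma transpose_border_wordT_cons (b : Bool) (a : Fin g ⊕ Fin g) (l : Word (Fin g)) :
    transpose (border b (wordT (a :: l))) =
      (if l = [] then if a.isLeft = b then 0 else Sum.elim hv hvT a else 0) +
        Sum.elim xv xvT a * transpose (border b (wordT l)) := by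
  rw [wordT_cons]
  by_cases hl : l = []
  · subst hl
    cases a <;> cases b <;> simp [border, hv, hvT, var, varT]
  · cases hw : wordT l with
    | nil => exact absurd ((wordT_eq_nil l).1 hw) hl
    | cons c m =>
      rw [if_neg hl, zero_add, List.cons_append, border, border]
      split_ifs
      · rw [xMonomial_append, ← mul_assoc, transpose_mul]
        simp [xMonomial_cons, transpose_xLetter]
      · simp

lemma wordHessian_cons (b : Bool) (a : Fin g ⊕ Fin g) (w : Word (Fin g)) :
    wordHessian b (a :: w) =
      (if a.isLeft = b then 0 else Sum.elim hv hvT a * wordDeriv b w) +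
        Sum.elim xv xvT a * wordHessian b w := by
  rw [wordHessian,
    sum_splits_cons (fun l r => transpose (border b (wordT l)) * wordDeriv b r), wordHessian]
  simp only [transpose_border_wordT_cons, add_mul, Finset.sum_add_distrib, wordT_nil,
    border_nil, transpose_zero, zero_mul, zero_add, Finset.mul_sum, mul_assoc]
  congr 1
  rw [Finset.sum_eq_single ([], w)]
  · simp
  · rintro ⟨l, r⟩ h hne
    have h' : l ++ r = w := by simpa using h
    have hl : l ≠ [] := by
      rintro rfl
      exact hne (by simp [← h'])
    simp [hl]
  · simp

lemma complexHessian_eq_coeff (p : NCPoly (Fin g)) :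
    complexHessian p = ((perturb g p).coeff 1).coeff 1 := by
  simp [complexHessian, ← Polynomial.coeff_zero_eq_eval_zero, Polynomial.coeff_derivative]

/-- All four low-order coefficients are carried together because the product rule for a prepended
letter mixes them. -/
lemma perturb_monomial_coeff (w : Word (Fin g)) :
    ((perturb g (monomial w)).coeff 0).coeff 0 = xMonomial w ∧
    ((perturb g (monomial w)).coeff 0).coeff 1 = wordDeriv true w ∧
    ((perturb g (monomial w)).coeff 1).coeff 0 = wordDeriv false w ∧
    ((perturb g (monomial w)).coeff 1).coeff 1 = wordHessian true w + wordHessian false w := by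
  induction w with
  | nil => simp [wordDeriv_nil, wordHessian_nil, Polynomial.coeff_one]
  | cons a w ih =>
    obtain ⟨h00, h10, h01, h11⟩ := ih
    rw [monomial_cons, map_mul]
    simp only [Polynomial.mul_coeff_zero, Polynomial.mul_coeff_one, Polynomial.coeff_add, h00,
      h10, h01, h11, xMonomial_cons, wordDeriv_cons, wordHessian_cons]
    cases a with
    | inl j =>
      simp [perturb, mul_add, Polynomial.coeff_X, Polynomial.coeff_C]
      constructor <;> abel
    | inr j =>
      simp [perturb, mul_add, Polynomial.coeff_X, Polynomial.coeff_C]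
      constructor <;> abel

/-- The product of a transposed border monomial, a monomial and a border monomial. -/
def polyKernel (b : Bool) (β u γ : Word (Fin g)) : NCPoly (Fin g ⊕ Fin g) :=
  transpose (border b β) * xMonomial u * border b γ

lemma polyKernel_eq_zero {b : Bool} (β u γ : Word (Fin g))
    (h : ¬ (HasType b β ∧ HasType b γ)) : polyKernel b β u γ = 0 := by
  unfold polyKernel
  by_cases hβ : HasType b β
  · rw [border_of_not (β := γ) fun hγ => h ⟨hβ, hγ⟩, mul_zero]
  · rw [border_of_not hβ, transpose_zero, zero_mul, zero_mul]

/-- Choosing the two differentiated letters of a word amounts to factoring it as `β^T u γ` with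
border words `β` and `γ` of type `b`. -/
lemma sum_wordHessian {D : ℕ} {P : Word (Fin g) → ℝ} (hP : IsSymmCoeff D P) (b : Bool) :
    ∑ w ∈ words (Fin g) D, P w • wordHessian b w = middleForm D P (polyKernel b) := by
  have h1 : ∀ w, P w • wordHessian b w = ∑ s ∈ splits w,
      P (s.1 ++ s.2) • (transpose (border b (wordT s.1)) * wordDeriv b s.2) := by
    intro w
    rw [wordHessian, Finset.smul_sum]
    exact Finset.sum_congr rfl fun s hs => by rw [mem_splits.1 hs]
  simp only [h1]
  rw [sum_words_splits D
    (fun l r => P (l ++ r) • (transpose (border b (wordT l)) * wordDeriv b r))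
    (fun l r h => by rw [hP.eq_zero _ (by simpa using h), zero_smul]), ← sum_words_wordT]
  refine Finset.sum_congr rfl fun β _ => ?_
  have h2 : ∀ r, P (wordT β ++ r) • (transpose (border b (wordT (wordT β))) * wordDeriv b r) =
      ∑ s ∈ splits r, P (wordT β ++ s.1 ++ s.2) • polyKernel b β s.1 s.2 := by
    intro r
    rw [wordDeriv, Finset.mul_sum, Finset.smul_sum]
    refine Finset.sum_congr rfl fun s hs => ?_
    rw [List.append_assoc, mem_splits.1 hs, wordT_wordT, polyKernel, mul_assoc]
  simp only [h2]
  rw [sum_words_splits D (fun u γ => P (wordT β ++ u ++ γ) • polyKernel b β u γ)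
    (fun l r h => by rw [hP.eq_zero _ (by simp; omega), zero_smul]), Finset.sum_comm]

lemma complexHessian_eq_middleForm {D : ℕ} {P : Word (Fin g) → ℝ} (hP : IsSymmCoeff D P) :
    complexHessian (∑ w ∈ words (Fin g) D, P w • monomial w) =
      middleForm D P (polyKernel true) + middleForm D P (polyKernel false) := by
  rw [← sum_wordHessian hP, ← sum_wordHessian hP, ← Finset.sum_add_distrib,
    complexHessian_eq_coeff]
  simp only [map_sum, map_smul, Polynomial.finsetSum_coeff, Polynomial.coeff_smul,
    (perturb_monomial_coeff _).2.2.2, smul_add]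

end HessianExpansion

/-! ### From positivity of the hessian to positivity of the middle matrices -/

section LocalPositivity

variable {g : ℕ} {n : Type} [Fintype n] [DecidableEq n]

lemma eval_xMonomial (Y H : Fin g → Matrix n n ℝ) (w : Word (Fin g)) :
    eval (Sum.elim Y H) (xMonomial w) = wordEval Y w := by
  induction w with
  | nil => simp
  | cons a w ih =>
    rw [xMonomial_cons, map_mul, ih, wordEval_cons]
    cases a <;> simp [eval, xv, xvT, var, varT]

lemma eval_hLetter (Y H : Fin g → Matrix n n ℝ) (a : Fin g ⊕ Fin g) :
    eval (Sum.elim Y H) (Sum.elim hv hvT a) = Sum.elim H (fun j => (H j)ᵀ) a := by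
  cases a <;> simp [eval, hv, hvT, var, varT]

lemma dotProduct_eval_middleForm (Y H : Fin g → Matrix n n ℝ) (D : ℕ)
    (P : Word (Fin g) → ℝ) (b : Bool) (w : n → ℝ) :
    w ⬝ᵥ (eval (Sum.elim Y H) (middleForm D P (polyKernel b)) *ᵥ w) =
      middleForm D P (evalKernel Y (fun β => eval (Sum.elim Y H) (border b β) *ᵥ w)
        fun β => eval (Sum.elim Y H) (border b β) *ᵥ w) := by
  simp only [middleForm, map_sum, map_smul, Matrix.sum_mulVec, dotProduct_sum,
    Matrix.smul_mulVec, dotProduct_smul]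
  refine Finset.sum_congr rfl fun β _ => Finset.sum_congr rfl fun γ _ =>
    Finset.sum_congr rfl fun u _ => ?_
  congr 1
  rw [polyKernel, evalKernel, map_mul, map_mul, eval_transpose, eval_xMonomial,
    ← Matrix.mulVec_mulVec, ← Matrix.mulVec_mulVec, Matrix.dotProduct_mulVec,
    Matrix.vecMul_transpose]

/-- The direct sum of two copies of `X`. -/
def double (X : Fin g → Matrix n n ℝ) : Fin g → Matrix (n ⊕ n) (n ⊕ n) ℝ :=
  fun j => Matrix.fromBlocks (X j) 0 0 (X j)

lemma wordEval_double (X : Fin g → Matrix n n ℝ) (w : Word (Fin g)) :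
    wordEval (double X) w = Matrix.fromBlocks (wordEval X w) 0 0 (wordEval X w) := by
  induction w with
  | nil => simp
  | cons a w ih =>
    rw [wordEval_cons, wordEval_cons, ih]
    cases a <;> simp [double, Matrix.fromBlocks_multiply, Matrix.fromBlocks_transpose]

/-- The block that sends the vectors `m(X) v` to prescribed values, if `μ` is dual to these
vectors. -/
def interpolant (D : ℕ) (μ z : Word (Fin g) → n → ℝ) (a : Fin g ⊕ Fin g) : Matrix n n ℝ :=
  ∑ m ∈ words (Fin g) D, Matrix.vecMulVec (z (a :: m)) (μ m)

lemma interpolant_mulVec {D : ℕ} {X : Fin g → Matrix n n ℝ} {v : n → ℝ}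
    {μ : Word (Fin g) → n → ℝ} (hX : IsDualFamily D X v μ) (z : Word (Fin g) → n → ℝ)
    (a : Fin g ⊕ Fin g) {m : Word (Fin g)} (hm : m.length ≤ D) :
    interpolant D μ z a *ᵥ (wordEval X m *ᵥ v) = z (a :: m) := by
  rw [interpolant, Matrix.sum_mulVec, Finset.sum_eq_single m]
  · rw [Matrix.vecMulVec_mulVec, (hX m m hm hm).1 rfl]
    simp
  · intro l hl hne
    rw [Matrix.vecMulVec_mulVec, (hX l m (by simpa using hl) hm).2 hne]
    simp
  · simp [hm]

/-- A direction in which the border monomials of type `b` take prescribed values and those of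
the other type vanish. -/
def direction (D : ℕ) (b : Bool) (μ z : Word (Fin g) → n → ℝ) (j : Fin g) :
    Matrix (n ⊕ n) (n ⊕ n) ℝ :=
  bif b then Matrix.fromBlocks 0 0 (interpolant D μ z (Sum.inl j)) 0
  else Matrix.fromBlocks 0 (interpolant D μ z (Sum.inr j))ᵀ 0 0

/-- The vector `(m(X) v, 0)` is sent to `(0, z β)` by the lower left block; the transposed direction
has only an upper right block and annihilates it. -/
lemma eval_border_mulVec {D : ℕ} {X : Fin g → Matrix n n ℝ} {v : n → ℝ}
    {μ : Word (Fin g) → n → ℝ} (hX : IsDualFamily D X v μ) (b : Bool)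
    (z : Word (Fin g) → n → ℝ) (c : Bool) {β : Word (Fin g)} (hβ : β.length ≤ D) :
    eval (Sum.elim (double X) (direction D b μ z)) (border c β) *ᵥ Sum.elim v 0 =
      if c = b ∧ HasType c β then Sum.elim (0 : n → ℝ) (z β) else 0 := by
  cases β with
  | nil => simp
  | cons a m =>
    have hm : m.length ≤ D := by simp at hβ; omega
    rw [border]
    by_cases ha : a.isLeft = c
    · rw [if_pos ha, map_mul, eval_xMonomial, eval_hLetter, ← Matrix.mulVec_mulVec,
        wordEval_double, Matrix.fromBlocks_mulVec]
      have h := interpolant_mulVec hX z a hm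
      have h0 : (fun _ : n => (0 : ℝ)) = 0 := rfl
      subst ha
      cases a <;> cases b <;>
        simp [direction, Matrix.fromBlocks_mulVec, Matrix.fromBlocks_transpose,
          Function.comp_def, h, h0]
    · simp [ha]

lemma middleForm_evalKernel_double (D : ℕ) (P : Word (Fin g) → ℝ) (X : Fin g → Matrix n n ℝ)
    (z : Word (Fin g) → n → ℝ) (z' : Word (Fin g) → n ⊕ n → ℝ)
    (hz : ∀ β, β.length ≤ D → z' β = Sum.elim (0 : n → ℝ) (z β)) :
    middleForm D P (evalKernel (double X) z' z') = middleForm D P (evalKernel X z z) := by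
  refine Finset.sum_congr rfl fun β hβ => Finset.sum_congr rfl fun γ hγ =>
    Finset.sum_congr rfl fun u _ => ?_
  rw [evalKernel, evalKernel, hz β (by simpa using hβ), hz γ (by simpa using hγ),
    wordEval_double, Matrix.fromBlocks_mulVec]
  simp [Function.comp_def]

lemma isPosAt_of_double {D : ℕ} {P : Word (Fin g) → ℝ} {X : Fin g → Matrix n n ℝ} {v : n → ℝ}
    {μ : Word (Fin g) → n → ℝ} (hX : IsDualFamily D X v μ)
    (h : ∀ (H : Fin g → Matrix (n ⊕ n) (n ⊕ n) ℝ) (w : n ⊕ n → ℝ),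
      0 ≤ w ⬝ᵥ (eval (Sum.elim (double X) H) (middleForm D P (polyKernel true) +
        middleForm D P (polyKernel false)) *ᵥ w)) (b : Bool) : IsPosAt D b X P := by
  intro z hz
  -- This direction isolates the form of type `b` in the sum of the two.
  have h1 := h (direction D b μ z) (Sum.elim v 0)
  rw [map_add, Matrix.add_mulVec, dotProduct_add, dotProduct_eval_middleForm,
    dotProduct_eval_middleForm] at h1
  have h2 : ∀ c, middleForm D P (evalKernel (double X)
      (fun β => eval (Sum.elim (double X) (direction D b μ z)) (border c β) *ᵥ Sum.elim v 0)
      fun β => eval (Sum.elim (double X) (direction D b μ z)) (border c β) *ᵥ Sum.elim v 0) =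
      if c = b then middleForm D P (evalKernel X z z) else 0 := by
    intro c
    split_ifs with hc
    · refine middleForm_evalKernel_double D P X z _ fun β hβ => ?_
      rw [eval_border_mulVec hX b z c hβ]
      split_ifs with hcb
      · rfl
      · rw [hz β fun hβ' => hcb ⟨hc, hc ▸ hβ'⟩]
        simp
    · rw [middleForm_evalKernel_double D P X 0 _ fun β hβ => ?_]
      · simp [middleForm, evalKernel]
      · rw [eval_border_mulVec hX b z c hβ, if_neg fun h => hc h.1]
        simp
  rw [h2, h2] at h1
  cases b <;> simpa using h1

/-- The index type of the direct sum of two blocks of size `n`. -/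
def sumEquivSigma (n : ℕ) : Fin n ⊕ Fin n ≃ Σ _ : Fin 2, Fin n where
  toFun := Sum.elim (fun i => ⟨0, i⟩) fun i => ⟨1, i⟩
  invFun s := if s.1 = 0 then Sum.inl s.2 else Sum.inr s.2
  left_inv i := by cases i <;> simp
  right_inv s := by
    obtain ⟨k, i⟩ := s
    fin_cases k <;> simp

lemma directSum_eq_reindex {n : ℕ} (X : MatTuple g n) :
    directSum (fun _ : Fin 2 => n) (fun _ => X) = fun j =>
      Matrix.reindex ((sumEquivSigma n).trans finSigmaFinEquiv)
        ((sumEquivSigma n).trans finSigmaFinEquiv) (double X j) := by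
  funext j
  have h : Matrix.blockDiagonal' (fun _ : Fin 2 => X j) =
      Matrix.reindex (sumEquivSigma n) (sumEquivSigma n) (double X j) := by
    ext ⟨k, i⟩ ⟨k', i'⟩
    fin_cases k <;> fin_cases k' <;>
      simp [sumEquivSigma, double, Matrix.blockDiagonal'_apply]
  rw [directSum, h]
  rfl

lemma isPosAt_of_isPlushOn {𝒢 : ∀ n : ℕ, Set (MatTuple g n)} (h𝒢 : IsNCOpen 𝒢)
    {D : ℕ} {P : Word (Fin g) → ℝ} (hP : IsSymmCoeff D P)
    (hplush : IsPlushOn (∑ w ∈ words (Fin g) D, P w • monomial w) 𝒢)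
    {n : ℕ} (hn : 1 ≤ n) {X : MatTuple g n} (hX𝒢 : X ∈ 𝒢 n) {v : Fin n → ℝ}
    {μ : Word (Fin g) → Fin n → ℝ} (hX : IsDualFamily D X v μ) (b : Bool) :
    IsPosAt D b X P := by
  refine isPosAt_of_double hX (fun H w => ?_) b
  have hmem := h𝒢.directSum_mem 2 (fun _ => n) (fun _ => X) (by norm_num) (fun _ => hn)
    fun _ => hX𝒢
  set e := (sumEquivSigma n).trans finSigmaFinEquiv with he
  have hpos := hplush _ (by simp; omega) _ hmem fun j => Matrix.reindex e e (H j)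
  have hXH : (Sum.elim (directSum (fun _ : Fin 2 => n) fun _ => X)
      fun j => Matrix.reindex e e (H j)) =
      fun s => Matrix.reindex e e (Sum.elim (double X) H s) := by
    rw [directSum_eq_reindex]
    funext s
    cases s <;> rfl
  rw [hXH, eval_reindex, Matrix.reindex_apply, Matrix.posSemidef_submatrix_equiv,
    complexHessian_eq_middleForm hP] at hpos
  simpa using hpos.dotProduct_mulVec_nonneg w

end LocalPositivity

/-! ### A point of the nc open set with independent word orbits -/

section GenericPoint

variable {σ n : Type}

open Classical in
/-- The tuple of matrices that act on basis vectors indexed by words as the sum of a creation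
operator and the transpose of another one; `ρ` labels the indices by words. -/
def fock (ρ : n → List (Option (σ ⊕ σ))) (j : σ) : Matrix n n ℝ := fun i k =>
  (if ρ i = some (Sum.inl j) :: ρ k then 1 else 0) +
    if ρ k = some (Sum.inr j) :: ρ i then 1 else 0

open Classical in
lemma fock_letter (ρ : n → List (Option (σ ⊕ σ))) (a : σ ⊕ σ) (i k : n) :
    (Sum.elim (fock ρ) (fun s => (fock ρ s)ᵀ) a : Matrix n n ℝ) i k =
      (if ρ i = some a :: ρ k then 1 else 0) + if ρ k = some a.swap :: ρ i then 1 else 0 := by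
  cases a <;> simp [fock, add_comm] <;> congr

variable [Fintype n] [DecidableEq n]

lemma wordEval_map {R S : Type} [CommRing R] [CommRing S] (f : R →+* S)
    (X : σ → Matrix n n R) (w : Word σ) :
    wordEval (fun j => (X j).map f) w = (wordEval X w).map f := by
  induction w with
  | nil => simp
  | cons a w ih =>
    rw [wordEval_cons, wordEval_cons, Matrix.map_mul, ih]
    cases a <;> simp [Matrix.transpose_map]

open Classical in
-- Each letter lengthens a label by at most one, so a label of length at least `w.length` is reached
-- from the empty one by creation steps alone, which spell out `w`.
lemma wordEval_fock {D : ℕ} {ρ : n → List (Option (σ ⊕ σ))} (hρ : Function.Injective ρ)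
    (hD : ∀ w : Word σ, w.length ≤ D → ∃ i, ρ i = w.map some) {i₀ : n} (hi₀ : ρ i₀ = [])
    {w : Word σ} (hw : w.length ≤ D) (i : n) (hi : w.length ≤ (ρ i).length) :
    wordEval (fock ρ) w i i₀ = if ρ i = w.map some then 1 else 0 := by
  induction w generalizing i with
  | nil =>
    rw [wordEval_nil, Matrix.one_apply]
    exact if_congr ⟨fun h => by simpa [h] using hi₀, fun h => hρ (by simpa [hi₀] using h)⟩ rfl rfl
  | cons a w ih =>
    simp only [List.length_cons] at hw hi
    obtain ⟨k₀, hk₀⟩ := hD w (by omega)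
    rw [wordEval_cons, Matrix.mul_apply, Finset.sum_eq_single k₀]
    · rw [ih (by omega) k₀ (by simp [hk₀]), fock_letter, hk₀, if_pos rfl, mul_one, List.map_cons,
        if_neg (c := w.map some = _), add_zero]
      intro h
      have := congrArg List.length h
      simp at this
      omega
    · intro k _ hk
      have hk' : ρ k ≠ w.map some := fun h => hk (hρ (h.trans hk₀.symm))
      rw [fock_letter]
      by_cases h1 : ρ i = some a :: ρ k
      · rw [ih (by omega) k (by rw [h1] at hi; simp at hi; omega), if_neg hk', mul_zero]
      by_cases h2 : ρ k = some a.swap :: ρ i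
      · rw [ih (by omega) k (by rw [h2]; simp; omega), if_neg hk', mul_zero]
      rw [if_neg h1, if_neg h2, add_zero, zero_mul]
    · simp

variable [Fintype σ]

/-- The coordinates, at the indices `ι l`, of the vectors obtained by applying words of length
at most `D` to the basis vector with index `i₀`. -/
def orbitMatrix {R : Type} [CommRing R] (D : ℕ) (ι : words σ D → n) (i₀ : n)
    (X : σ → Matrix n n R) : Matrix (words σ D) (words σ D) R :=
  fun l m => wordEval X m.1 (ι l) i₀

/-- The matrix is triangular with respect to length: in the row of a longest word `l` in the support
of a kernel vector, only the coordinate at `l` survives. -/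
lemma det_orbitMatrix_fock_ne_zero {D : ℕ} {ρ : n → List (Option (σ ⊕ σ))}
    (hρ : Function.Injective ρ) {ι : words σ D → n} (hι : ∀ w, ρ (ι w) = w.1.map some) {i₀ : n}
    (hi₀ : ρ i₀ = []) [DecidableEq (words σ D)] : (orbitMatrix D ι i₀ (fock ρ)).det ≠ 0 := by
  classical
  intro hdet
  obtain ⟨c, hc, hTc⟩ := Matrix.exists_mulVec_eq_zero_iff.2 hdet
  obtain ⟨w₀, hw₀⟩ := Function.ne_iff.1 hc
  obtain ⟨l, hl, hmax⟩ := Finset.exists_max_image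
    (Finset.univ.filter fun w : words σ D => c w ≠ 0) (fun w => w.1.length)
    ⟨w₀, by simpa using hw₀⟩
  simp only [Finset.mem_filter, Finset.mem_univ, true_and] at hl hmax
  apply hl
  have h := congrFun hTc l
  rw [Matrix.mulVec, dotProduct, Finset.sum_eq_single l] at h
  · rw [orbitMatrix, wordEval_fock hρ (fun w hw => ⟨ι ⟨w, by simpa using hw⟩, hι _⟩) hi₀
      (mem_words.1 l.2) _ (by simp [hι]), if_pos (hι l), one_mul] at h
    exact h
  · intro m _ hm
    by_cases hcm : c m = 0
    · rw [hcm, mul_zero]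
    · rw [orbitMatrix, wordEval_fock hρ (fun w hw => ⟨ι ⟨w, by simpa using hw⟩, hι _⟩) hi₀
        (mem_words.1 m.2) _ (by simpa [hι] using hmax m hcm), if_neg, zero_mul]
      rw [hι]
      exact fun h => hm (Subtype.ext
        ((List.map_injective_iff.2 (Option.some_injective _) h).symm))
  · simp

lemma exists_isDualFamily {D : ℕ} {ι : words σ D → n} {i₀ : n} {X : σ → Matrix n n ℝ}
    [DecidableEq (words σ D)] (hdet : (orbitMatrix D ι i₀ X).det ≠ 0) :
    ∃ (v : n → ℝ) (μ : Word σ → n → ℝ), IsDualFamily D X v μ := by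
  classical
  set T := orbitMatrix D ι i₀ X with hT
  have hinv : T⁻¹ * T = 1 := Matrix.nonsing_inv_mul _ (isUnit_iff_ne_zero.2 hdet)
  refine ⟨Pi.single i₀ 1, fun l => if h : l ∈ words σ D then
    ∑ l' : words σ D, T⁻¹ ⟨l, h⟩ l' • Pi.single (ι l') 1 else 0, fun l m hl hm => ?_⟩
  have hl' : l ∈ words σ D := by simpa using hl
  have hm' : m ∈ words σ D := by simpa using hm
  have key : (∑ l' : words σ D, T⁻¹ ⟨l, hl'⟩ l' • (Pi.single (ι l') 1 : n → ℝ)) ⬝ᵥ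
      (wordEval X m *ᵥ Pi.single i₀ 1) = (T⁻¹ * T) ⟨l, hl'⟩ ⟨m, hm'⟩ := by
    rw [sum_dotProduct, Matrix.mul_apply]
    refine Finset.sum_congr rfl fun l' _ => ?_
    simp [smul_dotProduct, hT, orbitMatrix]
  simp only [dif_pos hl', key, hinv, Matrix.one_apply]
  exact ⟨fun h => by simp [h], fun h => by simp [h]⟩


/-- On the line from `X` to `F` the determinant is a polynomial in the parameter, nonzero at `1`; it
cannot vanish on a whole neighbourhood of `0`. -/
lemma exists_mem_det_ne_zero {D : ℕ} {ι : words σ D → n} {i₀ : n} [DecidableEq (words σ D)]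
    {U : Set (σ → Matrix n n ℝ)} (hU : IsOpen U) {X : σ → Matrix n n ℝ} (hX : X ∈ U)
    {F : σ → Matrix n n ℝ} (hF : (orbitMatrix D ι i₀ F).det ≠ 0) :
    ∃ Y ∈ U, (orbitMatrix D ι i₀ Y).det ≠ 0 := by
  set Z : σ → Matrix n n (Polynomial ℝ) := fun j => (X j).map Polynomial.C +
    (Polynomial.X : Polynomial ℝ) • (F j - X j).map Polynomial.C with hZ
  set q := (orbitMatrix D ι i₀ Z).det with hq
  have hline : ∀ s : ℝ, (fun j => (Z j).map (Polynomial.evalRingHom s)) =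
      fun j => X j + s • (F j - X j) := by
    intro s
    funext j
    ext i k
    simp [hZ]
  have heval : ∀ s : ℝ, q.eval s =
      (orbitMatrix D ι i₀ fun j => X j + s • (F j - X j)).det := by
    intro s
    rw [← hline, ← Polynomial.coe_evalRingHom, hq, RingHom.map_det]
    congr 1
    ext l m
    change _ = wordEval (fun j => (Z j).map (Polynomial.evalRingHom s)) m.1 (ι l) i₀
    rw [wordEval_map]
    rfl
  have hq0 : q ≠ 0 := by
    intro h
    have := heval 1
    simp [h] at this
    exact hF this.symm
  have hnhds : {s : ℝ | (fun j => X j + s • (F j - X j)) ∈ U} ∈ nhds (0 : ℝ) := by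
    have hc : Continuous fun s : ℝ => fun j => X j + s • (F j - X j) := by fun_prop
    exact (hU.preimage hc).mem_nhds (by simpa using hX)
  by_contra hcon
  push Not at hcon
  refine hq0 (Polynomial.eq_zero_of_infinite_isRoot q
    ((infinite_of_mem_nhds 0 hnhds).mono fun s hs => ?_))
  exact (heval s).trans (hcon _ hs)

lemma exists_isDualFamily_of_isNCOpen {g : ℕ} {𝒢 : ∀ n : ℕ, Set (MatTuple g n)}
    (h𝒢 : IsNCOpen 𝒢) (hne : ∃ n : ℕ, 1 ≤ n ∧ (𝒢 n).Nonempty) (D : ℕ) :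
    ∃ n : ℕ, 1 ≤ n ∧ ∃ X ∈ 𝒢 n, ∃ (v : Fin n → ℝ) (μ : Word (Fin g) → Fin n → ℝ),
      IsDualFamily D X v μ := by
  classical
  obtain ⟨m, hm, X, hX⟩ := hne
  obtain ⟨n₀, -, hopen⟩ := h𝒢.isOpen
  set S : Finset (List (Option (Fin g ⊕ Fin g))) := (words (Fin g) D).image (List.map some)
  -- Enough copies for the size to exceed `n₀` and to provide an index for every word of length at
  -- most `D`.
  set t := n₀ + 1 + S.card with ht
  set n := ∑ _i : Fin t, m with hn
  have hnt : t ≤ n := by simpa [hn] using Nat.le_mul_of_pos_right t hm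
  have hmem := h𝒢.directSum_mem t (fun _ => m) (fun _ => X) (by omega) (fun _ => hm) fun _ => hX
  -- The extra letter `none` keeps the set of labels infinite even for `g = 0`, so the word labels
  -- can be padded to exactly `n`.
  obtain ⟨S', hSS', hcard⟩ := Infinite.exists_superset_card_eq S n (by omega)
  set ρ : Fin n → List (Option (Fin g ⊕ Fin g)) := fun i =>
    ((S'.equivFinOfCardEq hcard).symm i).1 with hρ
  have hinj : Function.Injective ρ :=
    Subtype.val_injective.comp (S'.equivFinOfCardEq hcard).symm.injective
  have hex : ∀ w : words (Fin g) D, ∃ i, ρ i = w.1.map some := fun w =>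
    ⟨S'.equivFinOfCardEq hcard ⟨_, hSS' (Finset.mem_image_of_mem _ w.2)⟩, by simp [hρ]⟩
  choose ι hι using hex
  have hi₀ : ρ (ι ⟨[], by simp⟩) = [] := by simp [hι]
  obtain ⟨Y, hY, hdet⟩ := exists_mem_det_ne_zero (hopen n (by omega)) hmem
    (det_orbitMatrix_fock_ne_zero hinj hι hi₀)
  exact ⟨n, by omega, Y, hY, exists_isDualFamily hdet⟩

end GenericPoint

/-! ### Assembling the matrix factorization -/

section Assembly

variable {g : ℕ}

lemma transpose_embed (p : NCPoly (Fin g)) :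
    transpose (embed g p) = embed g (transpose p) := by
  induction p using FreeAlgebra.induction with
  | grade0 r => simp [transpose]
  | grade1 v => cases v <;> simp [embed, xv, xvT, var, varT]
  | mul a b ha hb => simp only [map_mul, transpose_mul, ha, hb]
  | add a b ha hb => simp only [map_add, transpose_add, ha, hb]

lemma transpose_transpose {σ : Type} (p : NCPoly σ) : transpose (transpose p) = p := by
  induction p using FreeAlgebra.induction with
  | grade0 r => simp [transpose]
  | grade1 v => simp
  | mul a b ha hb => simp only [transpose_mul, ha, hb]
  | add a b ha hb => simp only [transpose_add, ha, hb]

lemma BorderMonomial.toPoly_eq_border (c : BorderMonomial g) :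
    c.toPoly = border c.head.isLeft (c.head :: c.tail) := by
  simp [BorderMonomial.toPoly, border, xMonomial]

/-- The linear form with coefficients `f` in the border monomials of type `b`. -/
def linearForm (D : ℕ) (b : Bool) (f : Word (Fin g) → ℝ) : NCPoly (Fin g ⊕ Fin g) :=
  ∑ γ ∈ words (Fin g) D, ∑ r ∈ words (Fin g) D, f (r ++ γ) • (xMonomial r * border b γ)

lemma squareForm_polyKernel (D : ℕ) (b : Bool) (f : Word (Fin g) → ℝ) :
    squareForm D f (polyKernel b) =
      transpose (linearForm D b f) * linearForm D b f := by
  unfold squareForm linearForm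
  rw [transpose_sum, Finset.sum_mul]
  refine Finset.sum_congr rfl fun β _ => ?_
  rw [Finset.sum_comm, transpose_sum, Finset.sum_mul]
  refine Finset.sum_congr rfl fun l _ => ?_
  rw [Finset.mul_sum]
  refine Finset.sum_congr rfl fun γ _ => ?_
  rw [Finset.mul_sum]
  refine Finset.sum_congr rfl fun r _ => ?_
  rw [transpose_smul, transpose_mul, smul_mul_smul_comm, transpose_xMonomial, polyKernel,
    xMonomial_append]
  simp only [mul_assoc]

lemma quadraticForm_ldl {N : ℕ} (V : Fin N → BorderMonomial g)
    (L : Matrix (Fin N) (Fin N) (NCPoly (Fin g))) (d : Fin N → ℝ) :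
    quadraticForm V (L * (Matrix.diagonal d).map (algebraMap ℝ (NCPoly (Fin g))) *
      matrixTranspose L) =
      ∑ i, d i • (transpose (∑ k, embed g (transpose (L k i)) * (V k).toPoly) *
        ∑ k, embed g (transpose (L k i)) * (V k).toPoly) := by
  have hentry : ∀ j k, (L * (Matrix.diagonal d).map (algebraMap ℝ (NCPoly (Fin g))) *
      matrixTranspose L) j k = ∑ i, d i • (L j i * transpose (L k i)) := by
    intro j k
    rw [Matrix.diagonal_map (map_zero _), Matrix.mul_apply]
    refine Finset.sum_congr rfl fun i _ => ?_
    rw [Matrix.mul_diagonal, ← Algebra.commutes, mul_assoc, ← Algebra.smul_def]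
    rfl
  have hleft : ∀ i, transpose (∑ k, embed g (transpose (L k i)) * (V k).toPoly) =
      ∑ k, transpose (V k).toPoly * embed g (L k i) := by
    intro i
    simp only [transpose_sum, transpose_mul, transpose_embed, transpose_transpose]
  have hl : quadraticForm V (L * (Matrix.diagonal d).map (algebraMap ℝ (NCPoly (Fin g))) *
      matrixTranspose L) = ∑ j, ∑ k, ∑ i, d i • (transpose (V j).toPoly * embed g (L j i) *
        (embed g (transpose (L k i)) * (V k).toPoly)) := by
    unfold quadraticForm
    rw [dotProduct]
    refine Finset.sum_congr rfl fun j _ => ?_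
    rw [Matrix.mulVec, dotProduct, Finset.mul_sum]
    refine Finset.sum_congr rfl fun k _ => ?_
    rw [Matrix.map_apply, hentry, map_sum, Finset.sum_mul, Finset.mul_sum]
    refine Finset.sum_congr rfl fun i _ => ?_
    rw [map_smul, map_mul, smul_mul_assoc, mul_smul_comm]
    simp only [mul_assoc]
  rw [hl]
  refine (Finset.sum_congr rfl fun j _ => Finset.sum_comm).trans (Finset.sum_comm.trans ?_)
  refine Finset.sum_congr rfl fun i _ => ?_
  simp only [hleft, Finset.sum_mul_sum, Finset.smul_sum]

lemma sum_words_eq_sum_enumeration {M : Type} [AddCommMonoid M] {D N : ℕ}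
    {V : Fin N → Word (Fin g)} (hinj : Function.Injective V) (hD : ∀ i, (V i).length ≤ D)
    (hV : ∀ β, β ≠ [] → β.length ≤ D → ∃ i, V i = β) (G : Word (Fin g) → M) (hG : G [] = 0) :
    ∑ γ ∈ words (Fin g) D, G γ = ∑ i, G (V i) := by
  symm
  refine Finset.sum_of_injOn V hinj.injOn (fun i _ => by simpa using hD i) ?_ fun _ _ => rfl
  intro β hβ hn
  by_cases h : β = []
  · rw [h, hG]
  · obtain ⟨i, hi⟩ := hV β h (by simpa using hβ)
    exact absurd ⟨i, by simp, hi⟩ hn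

end Assembly

end NCPlush

end

theorem theorem1p1 (g : ℕ) (p : NCPlush.NCPoly (Fin g)) (hp : NCPlush.IsSymmetric p)
    (𝒢 : ∀ n : ℕ, Set (NCPlush.MatTuple g n)) (h𝒢 : NCPlush.IsNCOpen 𝒢)
    (hne : ∃ n : ℕ, 1 ≤ n ∧ (𝒢 n).Nonempty) (hplush : NCPlush.IsPlushOn p 𝒢) :
    ∃ (N : ℕ) (V : Fin N → NCPlush.BorderMonomial g)
      (L : Matrix (Fin N) (Fin N) (NCPlush.NCPoly (Fin g))) (d : Fin N → ℝ),
      Function.Injective V ∧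
      NCPlush.IsUnitLowerTriangular L ∧
      (∀ i, 0 ≤ d i) ∧
      NCPlush.complexHessian p =
        NCPlush.quadraticForm V
          (L * (Matrix.diagonal d).map (algebraMap ℝ (NCPlush.NCPoly (Fin g))) *
            NCPlush.matrixTranspose L) := by
  classical
  open NCPlush in
  obtain ⟨D, P, hP, rfl⟩ := IsSymmetric.exists_coeff hp
  obtain ⟨n, hn, X, hX𝒢, v, μ, hX⟩ := exists_isDualFamily_of_isNCOpen h𝒢 hne D
  obtain ⟨N, V, hinj, hlen, hD, hnil, hV⟩ := exists_enumeration (Fin g) D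
  have hsq := fun b => exists_squares hX V hlen hD
    (fun β hβ => hV β fun h => not_hasType_nil b (h ▸ hβ)) hP
    (isPosAt_of_isPlushOn h𝒢 hP hplush hn hX𝒢 hX b)
  choose d f hd hf hsum using hsq
  let W : Fin N → BorderMonomial g := fun i => ⟨(V i).head (hnil i), (V i).tail⟩
  let τ : Fin N → Bool := fun i => ((V i).head (hnil i)).isLeft
  have hcons : ∀ i, (W i).head :: (W i).tail = V i := fun i => List.cons_head_tail (hnil i)
  have hτ : ∀ i b, HasType b (V i) ↔ τ i = b := fun i b => by
    rw [← hcons i, hasType_cons]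
  have hpoly : ∀ i, (W i).toPoly = border (τ i) (V i) := fun i => by
    rw [BorderMonomial.toPoly_eq_border, hcons]
  have hdτ : ∀ i b, b ≠ τ i → d b i = 0 := fun i b hb => by
    by_contra h
    exact hb ((hτ i b).1 (hf b i h).1).symm
  -- Column `i` holds the transposed coefficients of the `i`-th linear form, with zeros at border
  -- words of the other type. Where the weight is zero the column is immaterial to the form, and a
  -- column of the identity keeps `L` unit triangular.
  let L : Matrix (Fin N) (Fin N) (NCPoly (Fin g)) := fun j i =>
    if d (τ i) i = 0 then if j = i then 1 else 0
    else if τ j = τ i then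
      ∑ u ∈ words (Fin g) D, f (τ i) i (u ++ V j) • monomial (wordT u) else 0
  refine ⟨N, W, L, fun i => d (τ i) i, fun i j hij => hinj ?_, ⟨fun i => ?_, fun j i hji => ?_⟩,
    fun i => hd _ i, ?_⟩
  · rw [← hcons i, ← hcons j, hij]
  · simp only [L]
    split_ifs with h
    · rfl
    · rw [Finset.sum_eq_single []]
      · have hi := (hf _ i h).2.1 []
        simp only [List.nil_append, if_true] at hi
        simp [hi]
      · intro u _ hu
        rw [(hf _ i h).2.1, if_neg hu, zero_smul]
      · simp
  · simp only [L]
    split_ifs with h h1 h2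
    · exact absurd h1 hji.ne
    · rfl
    · refine Finset.sum_eq_zero fun u _ => ?_
      rw [(hf _ i h).2.2 j hji ((hτ j _).2 h2), zero_smul]
    · rfl
  · rw [complexHessian_eq_middleForm hP, hsum true _ _ polyKernel_eq_zero,
      hsum false _ _ polyKernel_eq_zero, ← Finset.sum_add_distrib, quadraticForm_ldl]
    refine Finset.sum_congr rfl fun i _ => ?_
    -- Both eliminations run along the same enumeration, but only the one matching the type of `V i`
    -- can have nonzero weight there.
    have h1 : d true i • squareForm D (f true i) (polyKernel true) +
        d false i • squareForm D (f false i) (polyKernel false) =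
        d (τ i) i • squareForm D (f (τ i) i) (polyKernel (τ i)) := by
      cases h : τ i
      · rw [hdτ i true (by simp [h]), zero_smul, zero_add]
      · rw [hdτ i false (by simp [h]), zero_smul, add_zero]
    rw [h1, squareForm_polyKernel]
    by_cases h0 : d (τ i) i = 0
    · rw [h0, zero_smul, zero_smul]
    have h2 : linearForm D (τ i) (f (τ i) i) =
        ∑ k, embed g (transpose (L k i)) * (W k).toPoly := by
      rw [linearForm, sum_words_eq_sum_enumeration hinj hD hV _ (by simp)]
      refine Finset.sum_congr rfl fun k _ => ?_
      simp only [L, if_neg h0, hpoly]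
      by_cases hk : τ k = τ i
      · rw [if_pos hk, hk, transpose_sum, map_sum, Finset.sum_mul]
        refine Finset.sum_congr rfl fun u _ => ?_
        rw [transpose_smul, transpose_monomial, wordT_wordT, map_smul, embed_monomial,
          smul_mul_assoc]
      · rw [if_neg hk, border_of_not fun h => hk ((hτ k _).1 h)]
        simp
    rw [h2]
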